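/- Let $K$ be any field, let $>$ be the degree reverse lexicographical ordering on the terms of $K[x,y,z,t]$ with $x>y>z>t$, and let $$F=(f_1,f_2,f_3)=(yz^3-x^2t^2,\;xz^2-y^2t,\;x^2y-z^2t).$$ Run the (incremental, signature-based) algorithm F5 on $F$: starting from $\{f_3\}$, it treats the indices $i=2$ and $i=1$ one after the other. In iteration $i$ it removes all critical pairs of the smallest remaining degree $d$, passes their s-polynomials that are not rejected by the Rewritten Criterion to the subalgorithm Reduction (pairs rejected by Faugère's Criterion are never formed), and adds the set $R_d$ of labeled polynomials returned by Reduction to the current set $G$ of labeled polynomials. For a set $S$ of polynomials let $HT(S)$ be the ideal generated by the head terms of the nonzero elements of $S$, and call a finite generating set of an ideal $I$ a $d$-Gröbner basis of $I$ if each of its s-polynomials of degree at most $d$ has a standard representation. Write $\mathrm{poly}(G)$ for the set of polynomial parts of the elements of $G$. Then, in whatever order critical pairs of equal degree are treated, F5 reaches, in iteration $i=1$, a state in which the smallest degree of a remaining critical pair is $d=8$, the set $\mathrm{poly}(G)$ is a $7$-Gröbner basis of $\langle f_1,f_2,f_3\rangle$, the call of Reduction at degree $8$ terminates, and its result $R_8$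 satisfies (A) $R_8\neq\emptyset$, and (B) $HT(\mathrm{poly}(G\cup R_8))=HT(\mathrm{poly}(G))$. Moreover, no polynomial has been reduced to zero by F5 up to and including this call. In particular it is false that, for every input and every degree $d$, if no polynomial is reduced to zero, then $HT(\mathrm{poly}(G\cup R_d))\neq HT(\mathrm{poly}(G))$ whenever $R_d\neq\emptyset$. -/

import Mathlib

noncomputable section

open scoped MonomialOrder Classical

/-! ### The degree reverse lexicographical ordering -/

/-- A type synonym of the exponent vectors, to be ordered by degree and then reverse
lexicographically. -/
def DegRevLexSyn (n : ℕ) : Type := Fin n →₀ ℕ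

namespace DegRevLexSyn

variable {n : ℕ}

instance : AddCommMonoid (DegRevLexSyn n) := inferInstanceAs (AddCommMonoid (Fin n →₀ ℕ))

/-- The sort key of an exponent vector: first the degree; for equal degrees the smaller exponent
at the last variable where two vectors differ wins. -/
def key (a : DegRevLexSyn n) : ℕ ×ₗ (Colex (Fin n →₀ ℕ))ᵒᵈ :=
  toLex (Finsupp.degree (show Fin n →₀ ℕ from a),
    OrderDual.toDual (toColex (show Fin n →₀ ℕ from a)))

theorem key_injective : Function.Injective (key (n := n)) := by
  intro a b h
  have h2 := congrArg (fun x => (ofLex x).2) h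
  exact h2

instance : LinearOrder (DegRevLexSyn n) := LinearOrder.lift' key key_injective

theorem lt_iff_key {a b : DegRevLexSyn n} : a < b ↔ key a < key b := Iff.rfl

theorem le_iff_key {a b : DegRevLexSyn n} : a ≤ b ↔ key a ≤ key b := Iff.rfl

theorem lt_iff {a b : Fin n →₀ ℕ} :
    (show DegRevLexSyn n from a) < (show DegRevLexSyn n from b) ↔
      a.degree < b.degree ∨
        a.degree = b.degree ∧ ∃ i, (∀ j, i < j → a j = b j) ∧ b i < a i := by
  rw [lt_iff_key]
  simp only [key, Prod.Lex.toLex_lt_toLex, OrderDual.toDual_lt_toDual, Finsupp.Colex.lt_iff]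
  refine or_congr Iff.rfl (and_congr Iff.rfl ⟨?_, ?_⟩)
  · rintro ⟨i, h, h'⟩
    exact ⟨i, fun j hj => (h j hj).symm, h'⟩
  · rintro ⟨i, h, h'⟩
    exact ⟨i, fun j hj => (h j hj).symm, h'⟩

theorem key_add_le {a b : DegRevLexSyn n} (h : key a ≤ key b) (c : DegRevLexSyn n) :
    key (a + c) ≤ key (b + c) := by
  simp only [key, Prod.Lex.toLex_le_toLex, OrderDual.toDual_le_toDual] at h ⊢
  have hd : ∀ x y : Fin n →₀ ℕ, Finsupp.degree (x + y) = Finsupp.degree x + Finsupp.degree y :=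
    fun x y => map_add _ x y
  rcases h with h | ⟨h, h'⟩
  · left
    exact (hd a c).trans_lt ((Nat.add_lt_add_right h _).trans_eq (hd b c).symm)
  · right
    refine ⟨(hd a c).trans ((congrArg (· + _) h).trans (hd b c).symm), ?_⟩
    exact add_le_add_left h' (toColex (show Fin n →₀ ℕ from c))

instance : IsOrderedAddMonoid (DegRevLexSyn n) where
  add_le_add_left _ _ h c := key_add_le h c

theorem monotone_of : Monotone (fun a : Fin n →₀ ℕ => (show DegRevLexSyn n from a)) := by
  intro a b h
  obtain ⟨c, rfl⟩ := exists_add_of_le h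
  have h0 : key (show DegRevLexSyn n from (0 : Fin n →₀ ℕ)) ≤ key (show DegRevLexSyn n from c) := by
    simp only [key, Prod.Lex.toLex_le_toLex, OrderDual.toDual_le_toDual]
    rcases Nat.eq_zero_or_pos c.degree with hc | hc
    · right
      have : c = 0 := (Finsupp.degree_eq_zero_iff c).1 hc
      subst this
      exact ⟨rfl, le_rfl⟩
    · left
      simpa using hc
  have h1 := key_add_le h0 (show DegRevLexSyn n from a)
  have e1 : (show DegRevLexSyn n from (0 : Fin n →₀ ℕ)) + (show DegRevLexSyn n from a)
      = (show DegRevLexSyn n from a) := zero_add (M := Fin n →₀ ℕ) a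
  have e2 : (show DegRevLexSyn n from c) + (show DegRevLexSyn n from a)
      = (show DegRevLexSyn n from (a + c)) := add_comm (G := Fin n →₀ ℕ) c a
  rw [e1, e2] at h1
  exact h1

instance : WellFoundedLT (DegRevLexSyn n) := by
  have : WellQuasiOrderedLE (DegRevLexSyn n) :=
    Monotone.wellQuasiOrderedLE_of_wellQuasiOrderedLE_of_surjective (α := Fin n →₀ ℕ) monotone_of (fun a => ⟨a, rfl⟩)
  infer_instance

end DegRevLexSyn

/-- The degree reverse lexicographical ordering with `X 0 > X 1 > ⋯ > X (n - 1)`. -/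
def degRevLex (n : ℕ) : MonomialOrder (Fin n) where
  syn := DegRevLexSyn n
  toSyn :=
    { toFun := fun a => a
      invFun := fun a => a
      left_inv := fun _ => rfl
      right_inv := fun _ => rfl
      map_add' := fun _ _ => rfl }
  toSyn_monotone := DegRevLexSyn.monotone_of

theorem degRevLex_lt_iff {n : ℕ} {a b : Fin n →₀ ℕ} :
    a ≺[degRevLex n] b ↔
      a.degree < b.degree ∨
        a.degree = b.degree ∧ ∃ i, (∀ j, i < j → a j = b j) ∧ b i < a i :=
  DegRevLexSyn.lt_iff (a := a) (b := b)

/-! ### Gröbner basics -/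

section Groebner

variable {σ K : Type*} [Field K] (ord : MonomialOrder σ)

/-- `HT(S)`: the ideal generated by the head terms of the nonzero elements of `S`. -/
def headIdeal (S : Set (MvPolynomial σ K)) : Ideal (MvPolynomial σ K) :=
  Ideal.span {q | ∃ p ∈ S, p ≠ 0 ∧ q = MvPolynomial.monomial (ord.degree p) 1}

/-- `p` has a standard representation with respect to `G`. -/
def HasStdRep (G : Set (MvPolynomial σ K)) (p : MvPolynomial σ K) : Prop :=
  p = 0 ∨ ∃ (k : ℕ) (c q : Fin k → MvPolynomial σ K),
    (∀ i, q i ∈ G) ∧ p = ∑ i, c i * q i ∧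
      ∀ i, c i * q i ≠ 0 → ord.degree (c i * q i) ≼[ord] ord.degree p

/-- `G` is a `d`-Gröbner basis of `I`: a basis of `I` such that all s-polynomials up to degree `d`
have standard representations. -/
def IsGroebnerUpTo (d : ℕ) (G : Set (MvPolynomial σ K)) (I : Ideal (MvPolynomial σ K)) : Prop :=
  G.Finite ∧ Ideal.span G = I ∧
    ∀ p ∈ G, ∀ q ∈ G, (ord.sPolynomial p q).totalDegree ≤ d →
      HasStdRep ord G (ord.sPolynomial p q)

/-- One reduction step modulo `B`: a term of `p` which is a multiple of the head term of some
`b ∈ B` is cancelled by the corresponding multiple of `b`. -/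
def ReducesTo (B : Set (MvPolynomial σ K)) (p p' : MvPolynomial σ K) : Prop :=
  ∃ b ∈ B, b ≠ 0 ∧ ∃ e ∈ p.support, ord.degree b ≤ e ∧
    p' = p - MvPolynomial.monomial (e - ord.degree b) (p.coeff e / ord.leadingCoeff b) * b

/-- `q` is a normal form of `p` modulo `B`: `p` reduces to `q`, and `q` is irreducible. -/
def IsNormalForm (B : Set (MvPolynomial σ K)) (p q : MvPolynomial σ K) : Prop :=
  Relation.ReflTransGen (ReducesTo ord B) p q ∧ ∀ q', ¬ ReducesTo ord B q q'

/-- The normal form `φ(p, B)`; it is unique when `B` is a Gröbner basis. -/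
def normalForm (B : Set (MvPolynomial σ K)) (p : MvPolynomial σ K) : MvPolynomial σ K :=
  Classical.epsilon (IsNormalForm ord B p)

/-- `p` divided by its head coefficient. -/
def makeMonic (p : MvPolynomial σ K) : MvPolynomial σ K :=
  MvPolynomial.C (ord.leadingCoeff p)⁻¹ * p

end Groebner

/-! ### The algorithm F5

The input is a list `f_0, …, f_m` (indices start at `0`). The iterations run through the indices
`m, m - 1, …, 0`; iteration `i` turns a Gröbner basis of `⟨f_{i+1}, …, f_m⟩` into one of
`⟨f_i, …, f_m⟩`. -/

namespace F5

variable {σ K : Type*} [Field K] {m : ℕ} (ord : MonomialOrder σ)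

/-- The signature `t 𝐅_i`. -/
structure Signature (σ : Type*) (m : ℕ) where
  term : σ →₀ ℕ
  idx : Fin (m + 1)

/-- The ordering `≺` of signatures: a larger index means a smaller signature. -/
def Signature.Lt (s t : Signature σ m) : Prop :=
  t.idx < s.idx ∨ s.idx = t.idx ∧ s.term ≺[ord] t.term

def Signature.Le (s t : Signature σ m) : Prop :=
  s = t ∨ s.Lt ord t

/-- `u (t 𝐅_i) = (u t) 𝐅_i`. -/
def Signature.shift (u : σ →₀ ℕ) (s : Signature σ m) : Signature σ m :=
  ⟨u + s.term, s.idx⟩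

/-- A labeled polynomial `r_k`, together with its number `k`. -/
structure LabeledPoly (σ K : Type*) [Field K] (m : ℕ) where
  num : ℕ
  sig : Signature σ m
  poly : MvPolynomial σ K

/-- The head term of the polynomial part. -/
def LabeledPoly.ht (r : LabeledPoly σ K m) : σ →₀ ℕ := ord.degree r.poly

/-- `poly(G)`. -/
def polys (G : List (LabeledPoly σ K m)) : Set (MvPolynomial σ K) :=
  {p | ∃ r ∈ G, r.poly = p}

/-- `poly(G_{i+1})`: the polynomial parts of the elements of `G` of index greater than `i`. -/
def polysAbove (i : Fin (m + 1)) (G : List (LabeledPoly σ K m)) : Set (MvPolynomial σ K) :=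
  {p | ∃ r ∈ G, i < r.sig.idx ∧ r.poly = p}

/-- `u r` is detected by Faugère's Criterion. -/
def FaugereDetected (G : List (LabeledPoly σ K m)) (u : σ →₀ ℕ) (r : LabeledPoly σ K m) : Prop :=
  ∃ g ∈ G, r.sig.idx < g.sig.idx ∧ g.ht ord ≤ u + r.sig.term

/-- The list of rules: the signature and the number of every labeled polynomial created by `spol`
or `topReduction`, whether it is already in `G`, still being reduced, or was reduced to zero. -/
abbrev Rules (σ : Type*) (m : ℕ) := List (Signature σ m × ℕ)

/-- `u r` is detected by the Rewritten Criterion: a labeled polynomial of the same index that was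
created later than `r` has a signature term dividing that of `u r`. -/
def Rewritten (rules : Rules σ m) (u : σ →₀ ℕ) (r : LabeledPoly σ K m) : Prop :=
  ∃ a ∈ rules, a.1.idx = r.sig.idx ∧ r.num < a.2 ∧ a.1.term ≤ u + r.sig.term

/-- A critical pair; its s-polynomial is `u₁ r₁ - u₂ r₂`, and `r₁` carries the larger
signature. -/
structure CritPair (σ K : Type*) [Field K] (m : ℕ) where
  lcm : σ →₀ ℕ
  u₁ : σ →₀ ℕ
  r₁ : LabeledPoly σ K m
  u₂ : σ →₀ ℕ
  r₂ : LabeledPoly σ K m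

/-- The degree of a critical pair. -/
def CritPair.deg (p : CritPair σ K m) : ℕ := p.lcm.degree

/-- The critical pair of `r` and `s`, without any test. -/
def orientedPair (r s : LabeledPoly σ K m) : CritPair σ K m :=
  let t := r.ht ord ⊔ s.ht ord
  let u := t - r.ht ord
  let v := t - s.ht ord
  if (r.sig.shift u).Lt ord (s.sig.shift v) then ⟨t, v, s, u, r⟩ else ⟨t, u, r, v, s⟩

/-- `CritPair`: the critical pair of `r` and `s` in iteration `i`, unless Faugère's Criterion
rejects one of its components of index `i`. The components of larger index come from an earlier,
finished iteration and are not tested. -/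
def critPair (i : Fin (m + 1)) (G : List (LabeledPoly σ K m)) (r s : LabeledPoly σ K m) :
    Option (CritPair σ K m) :=
  let p := orientedPair ord r s
  if i < p.r₁.sig.idx then none
  else if FaugereDetected ord G p.u₁ p.r₁ then none
  else if p.r₂.sig.idx = i ∧ FaugereDetected ord G p.u₂ p.r₂ then none
  else some p

/-- The data of a call of `Reduction`: `todo` is kept sorted by increasing signature, `done`
collects the result `R_d`, `count` is the number of labeled polynomials created so far (and the
number of the next one), and `zeros` lists the labeled polynomials that were reduced to zero since
the start of the algorithm. -/
structure RedState (σ K : Type*) [Field K] (m : ℕ) where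
  todo : List (LabeledPoly σ K m)
  done : List (LabeledPoly σ K m)
  count : ℕ
  rules : Rules σ m
  zeros : List (LabeledPoly σ K m)

/-- Insertion into a list sorted by increasing signature. -/
def insertBySig (r : LabeledPoly σ K m) (l : List (LabeledPoly σ K m)) :
    List (LabeledPoly σ K m) :=
  l.orderedInsert (fun a b => a.sig.Le ord b.sig) r

/-- `Spol`: the pairs are treated one after the other; a pair with a component that is detected by
the Rewritten Criterion is dropped, any other pair gives a new labeled polynomial and a new rule. -/
def spol : List (CritPair σ K m) → RedState σ K m → RedState σ K m
  | [], s => s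
  | p :: ps, s =>
    if Rewritten s.rules p.u₁ p.r₁ ∨ Rewritten s.rules p.u₂ p.r₂ then spol ps s
    else
      let r : LabeledPoly σ K m :=
        ⟨s.count, p.r₁.sig.shift p.u₁,
          MvPolynomial.monomial p.u₁ 1 * p.r₁.poly - MvPolynomial.monomial p.u₂ 1 * p.r₂.poly⟩
      spol ps
        { s with
          todo := insertBySig ord r s.todo
          count := s.count + 1
          rules := (r.sig, r.num) :: s.rules }

/-- `g` is an admissible reducer of `r` in iteration `i`: neither criterion detects the multiple
`u g` with the head term of `r`, and its signature is not that of `r`. -/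
def IsReducer (i : Fin (m + 1)) (G : List (LabeledPoly σ K m)) (rules : Rules σ m)
    (r g : LabeledPoly σ K m) : Prop :=
  g.sig.idx = i ∧ g.ht ord ≤ r.ht ord ∧
    ¬ FaugereDetected ord G (r.ht ord - g.ht ord) g ∧
    ¬ Rewritten rules (r.ht ord - g.ht ord) g ∧
    g.sig.shift (r.ht ord - g.ht ord) ≠ r.sig

/-- `IsReducible`: the first admissible reducer in the list, if there is one. -/
def findReducer (i : Fin (m + 1)) (G : List (LabeledPoly σ K m)) (rules : Rules σ m)
    (r : LabeledPoly σ K m) : Option (LabeledPoly σ K m) :=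
  G.find? (fun g => decide (IsReducer ord i G rules r g))

/-- `TopReduction`, applied to `r`, which has been removed from `todo`. -/
def topReduction (i : Fin (m + 1)) (G : List (LabeledPoly σ K m)) (r : LabeledPoly σ K m)
    (s : RedState σ K m) : RedState σ K m :=
  if r.poly = 0 then { s with zeros := s.zeros ++ [r] }
  else
    match findReducer ord i (G ++ s.done) s.rules r with
    | none => { s with done := s.done ++ [{ r with poly := makeMonic ord r.poly }] }
    | some g =>
      let u := r.ht ord - g.ht ord
      let c := ord.leadingCoeff r.poly
      if (g.sig.shift u).Lt ord r.sig then
        { s with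
          todo := insertBySig ord
            { r with poly := r.poly - MvPolynomial.monomial u c * g.poly } s.todo }
      else
        let r' : LabeledPoly σ K m :=
          ⟨s.count, g.sig.shift u, MvPolynomial.monomial u c * g.poly - r.poly⟩
        { s with
          todo := insertBySig ord r' (insertBySig ord r s.todo)
          count := s.count + 1
          rules := (r'.sig, r'.num) :: s.rules }

/-- One pass of the loop of `Reduction`: the element of `todo` of smallest signature is replaced by
its normal form with respect to `G_{i+1}` and handed to `topReduction`. -/
def reductionStep (i : Fin (m + 1)) (G : List (LabeledPoly σ K m)) (s : RedState σ K m) :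
    RedState σ K m :=
  match s.todo with
  | [] => s
  | r :: rest =>
    topReduction ord i G { r with poly := normalForm ord (polysAbove i G) r.poly }
      { s with todo := rest }

/-- `Reduction`: the loop is run until `todo` is empty. The value is `none` if this never
happens. -/
def reduction (i : Fin (m + 1)) (G : List (LabeledPoly σ K m)) (s : RedState σ K m) :
    Option (RedState σ K m) :=
  if h : ∃ n, ((reductionStep ord i G)^[n] s).todo = [] then
    some ((reductionStep ord i G)^[Nat.find h] s)
  else none

/-- The state of F5 between two degree steps of iteration `cur`. -/
structure State (σ K : Type*) [Field K] (m : ℕ) where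
  cur : Fin (m + 1)
  G : List (LabeledPoly σ K m)
  pairs : List (CritPair σ K m)
  count : ℕ
  rules : Rules σ m
  zeros : List (LabeledPoly σ K m)

/-- `r_i = (𝐅_i, f_i)`, with `f_i` made monic; it has the number `i`. -/
def inputPoly (F : Fin (m + 1) → MvPolynomial σ K) (i : Fin (m + 1)) : LabeledPoly σ K m :=
  ⟨i, ⟨0, i⟩, makeMonic ord (F i)⟩

/-- The start: `G` holds only the last input polynomial. -/
def State.init (F : Fin (m + 1) → MvPolynomial σ K) : State σ K m :=
  ⟨Fin.last m, [inputPoly ord F (Fin.last m)], [], m + 1, [], []⟩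

/-- The beginning of iteration `i`. -/
def State.startIteration (F : Fin (m + 1) → MvPolynomial σ K) (i : Fin (m + 1))
    (s : State σ K m) : State σ K m :=
  { s with
    cur := i
    G := s.G ++ [inputPoly ord F i]
    pairs := s.G.filterMap (critPair ord i s.G (inputPoly ord F i)) }

/-- The smallest degree `d` of a critical pair that is left. -/
def State.nextDegree (s : State σ K m) : Option ℕ := (s.pairs.map CritPair.deg).min?

/-- `Spol` and `Reduction` for the pairs of degree `d`; the field `done` of the value is `R_d`.
The function `sel` decides in which order the pairs of the same degree are treated. -/
def State.reduceDegree (sel : List (CritPair σ K m) → List (CritPair σ K m)) (d : ℕ)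
    (s : State σ K m) : Option (RedState σ K m) :=
  reduction ord s.cur s.G
    (spol ord (sel (s.pairs.filter (fun p => p.deg = d))) ⟨[], [], s.count, s.rules, s.zeros⟩)

/-- Add `r` to `G`, after forming its critical pairs with the elements of `G`. -/
def State.addPoly (s : State σ K m) (r : LabeledPoly σ K m) : State σ K m :=
  { s with
    pairs := s.pairs ++ s.G.filterMap (critPair ord s.cur s.G r)
    G := s.G ++ [r] }

/-- The effect of the degree step `d` whose call of `Reduction` ended with `t`. -/
def State.finishDegree (d : ℕ) (s : State σ K m) (t : RedState σ K m) : State σ K m :=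
  t.done.foldl (State.addPoly ord)
    { s with
      pairs := s.pairs.filter (fun p => p.deg ≠ d)
      count := t.count
      rules := t.rules
      zeros := t.zeros }

/-- One step of F5: a degree step if there are critical pairs, otherwise the beginning of the next
iteration. The value is `none` after the end of the last iteration. -/
def State.step (sel : List (CritPair σ K m) → List (CritPair σ K m))
    (F : Fin (m + 1) → MvPolynomial σ K) (s : State σ K m) : Option (State σ K m) :=
  match s.nextDegree with
  | some d => (s.reduceDegree ord sel d).map (s.finishDegree ord d)
  | none =>
    if s.cur = 0 then none
    else some (s.startIteration ord F ⟨s.cur - 1, by omega⟩)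

/-- The state of F5 on the input `F` after `n` steps. -/
def run (sel : List (CritPair σ K m) → List (CritPair σ K m))
    (F : Fin (m + 1) → MvPolynomial σ K) : ℕ → Option (State σ K m)
  | 0 => some (State.init ord F)
  | n + 1 => (run sel F n).bind (State.step ord sel F)

end F5

/-- The input `(y z³ - x² t², x z² - y² t, x² y - z² t)`; the variables `x, y, z, t` are
`X 0, X 1, X 2, X 3`. -/
def faugereInput (K : Type*) [Field K] : Fin 3 → MvPolynomial (Fin 4) K :=
  let x := MvPolynomial.X 0
  let y := MvPolynomial.X 1
  let z := MvPolynomial.X 2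
  let t := MvPolynomial.X 3
  ![y * z ^ 3 - x ^ 2 * t ^ 2, x * z ^ 2 - y ^ 2 * t, x ^ 2 * y - z ^ 2 * t]

end

/-!
The input polynomials are differences of two monomials, hence so are all polynomials that F5 meets,
and a run of F5 is a computation with pairs of exponent vectors that does not see the field. A
normal form is an arbitrary choice of an irreducible reduct; it is nevertheless determined by the
exponents, because the s-polynomials of the polynomials of larger index reduce to zero, so that the
rewriting system `b.1 ↦ b.2` on exponents is confluent and an irreducible polynomial in its ideal
vanishes. The run on Faugère's input is then evaluated for every order of the critical pairs of
equal degree: nothing reduces to zero, and at degree `8` every head term of the result is a multiple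
of an older one.
-/

open scoped MonomialOrder

/-! ### Rewriting of exponent vectors by binomials -/

section AbstractRewriting

open Relation

variable {α : Type*} {r : α → α → Prop}

/-- **Newman's lemma** -/
theorem join_of_locallyConfluent (hwf : WellFounded (flip r))
    (hloc : ∀ a b c, r a b → r a c → Join (ReflTransGen r) b c) {a b c : α}
    (hab : ReflTransGen r a b) (hac : ReflTransGen r a c) : Join (ReflTransGen r) b c := by
  induction a using hwf.induction generalizing b c with
  | _ a ih =>
    rcases hab.cases_head with rfl | ⟨b', hab', hb⟩
    · exact ⟨c, hac, .refl⟩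
    rcases hac.cases_head with rfl | ⟨c', hac', hc⟩
    · exact ⟨b, .refl, hab⟩
    obtain ⟨d, hbd, hcd⟩ := hloc a b' c' hab' hac'
    obtain ⟨e, hbe, hde⟩ := ih b' hab' hb hbd
    obtain ⟨f, hef, hcf⟩ := ih c' hac' (hcd.trans hde) hc
    exact ⟨f, hbe.trans hef, hcf⟩

theorem join_of_eqvGen_of_locallyConfluent (hwf : WellFounded (flip r))
    (hloc : ∀ a b c, r a b → r a c → Join (ReflTransGen r) b c) {a b : α} (h : EqvGen r a b) :
    Join (ReflTransGen r) a b :=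
  (equivalence_join fun _ _ _ => join_of_locallyConfluent hwf hloc).eqvGen_iff.1 <|
    h.mono fun _ b hab => ⟨b, .single hab, .refl⟩

end AbstractRewriting

/-- The two results of rewriting the least common multiple of `b.1` and `c.1` by `b.1 ↦ b.2` and
by `c.1 ↦ c.2`: the exponents of the s-polynomial of two binomials. The carrier `M` is arbitrary
because this is computed both for `σ →₀ ℕ` and for `Fin n → ℕ`. -/
def sPair {M : Type*} [Max M] [Sub M] [Add M] (b c : M × M) : M × M :=
  (b.1 ⊔ c.1 - b.1 + b.2, b.1 ⊔ c.1 - c.1 + c.2)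

section Rewriting

open Relation

variable {σ : Type*} {B : Set ((σ →₀ ℕ) × (σ →₀ ℕ))} {a a' : σ →₀ ℕ}

/-- One step of the rewriting system with the rules `b.1 ↦ b.2` for `b ∈ B`. -/
def Rewrites (B : Set ((σ →₀ ℕ) × (σ →₀ ℕ))) (a a' : σ →₀ ℕ) : Prop :=
  ∃ b ∈ B, ∃ w, a = w + b.1 ∧ a' = w + b.2

/-- No rule applies to `a`. -/
def IsIrreducibleExponent (B : Set ((σ →₀ ℕ) × (σ →₀ ℕ))) (a : σ →₀ ℕ) : Prop :=
  ∀ b ∈ B, ¬ b.1 ≤ a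

theorem rewrites_sub_add {b : (σ →₀ ℕ) × (σ →₀ ℕ)} (hb : b ∈ B) (h : b.1 ≤ a) :
    Rewrites B a (a - b.1 + b.2) :=
  ⟨b, hb, a - b.1, (tsub_add_cancel_of_le h).symm, rfl⟩

theorem IsIrreducibleExponent.not_rewrites (h : IsIrreducibleExponent B a) : ¬ Rewrites B a a' := by
  rintro ⟨b, hb, w, rfl, -⟩
  exact h b hb le_add_self

theorem IsIrreducibleExponent.eq_of_reflTransGen (h : IsIrreducibleExponent B a)
    (haa' : ReflTransGen (Rewrites B) a a') : a' = a :=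
  (reflTransGen_iff_eq fun _ => h.not_rewrites).1 haa'

theorem Rewrites.reflTransGen_add_left (h : ReflTransGen (Rewrites B) a a') (w : σ →₀ ℕ) :
    ReflTransGen (Rewrites B) (w + a) (w + a') := by
  refine ReflTransGen.lift (w + ·) (fun _ _ => ?_) _ _ h
  rintro ⟨b, hb, v, rfl, rfl⟩
  exact ⟨b, hb, w + v, (add_assoc _ _ _).symm, (add_assoc _ _ _).symm⟩

theorem tsub_sup_add_of_add_eq_add {a b v w : σ →₀ ℕ} (h : v + a = w + b) :
    v + a - a ⊔ b + (a ⊔ b - a) = v := by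
  ext i
  have := DFunLike.congr_fun h i
  simp only [Finsupp.add_apply, Finsupp.sup_apply, Finsupp.tsub_apply] at this ⊢
  omega

theorem join_of_join_sPair
    (hB : ∀ b ∈ B, ∀ c ∈ B,
      Join (ReflTransGen (Rewrites B)) (sPair b c).1 (sPair b c).2)
    {a₁ a₂ : σ →₀ ℕ} (h₁ : Rewrites B a a₁) (h₂ : Rewrites B a a₂) :
    Join (ReflTransGen (Rewrites B)) a₁ a₂ := by
  obtain ⟨b, hb, v, rfl, rfl⟩ := h₁
  obtain ⟨c, hc, w, h, rfl⟩ := h₂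
  obtain ⟨d, hbd, hcd⟩ := hB b hb c hc
  set u := v + b.1 - b.1 ⊔ c.1 with hu
  have hv : u + (b.1 ⊔ c.1 - b.1) = v := tsub_sup_add_of_add_eq_add h
  have hw : u + (b.1 ⊔ c.1 - c.1) = w := by
    rw [hu, h, sup_comm]
    exact tsub_sup_add_of_add_eq_add h.symm
  refine ⟨u + d, ?_, ?_⟩
  · rw [← hv, add_assoc]
    exact Rewrites.reflTransGen_add_left hbd u
  · rw [← hw, add_assoc]
    exact Rewrites.reflTransGen_add_left hcd u

variable {ord : MonomialOrder σ}

/-- All rules decrease exponents, hence rewriting terminates. -/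
def IsOriented (ord : MonomialOrder σ) (B : Set ((σ →₀ ℕ) × (σ →₀ ℕ))) : Prop :=
  ∀ b ∈ B, b.2 ≺[ord] b.1

/-- A terminating rewriting system whose s-pairs are joinable; equivalently, the binomials of `B`
are a Gröbner basis of the ideal they generate. -/
structure IsConvergent (ord : MonomialOrder σ) (B : Set ((σ →₀ ℕ) × (σ →₀ ℕ))) : Prop where
  isOriented : IsOriented ord B
  join_sPair : ∀ b ∈ B, ∀ c ∈ B,
    Join (ReflTransGen (Rewrites B)) (sPair b c).1 (sPair b c).2

theorem IsOriented.lt_of_rewrites (hB : IsOriented ord B) (h : Rewrites B a a') :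
    a' ≺[ord] a := by
  obtain ⟨b, hb, w, rfl, rfl⟩ := h
  simpa using hB b hb

theorem IsOriented.wellFounded (hB : IsOriented ord B) : WellFounded (flip (Rewrites B)) :=
  Subrelation.wf (hB.lt_of_rewrites ·) (InvImage.wf ord.toSyn wellFounded_lt)

namespace IsConvergent

theorem join_of_eqvGen (hB : IsConvergent ord B) (h : EqvGen (Rewrites B) a a') :
    Join (ReflTransGen (Rewrites B)) a a' :=
  join_of_eqvGen_of_locallyConfluent hB.isOriented.wellFounded
    (fun _ _ _ => join_of_join_sPair hB.join_sPair) h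

theorem injOn_quotMk (hB : IsConvergent ord B) :
    Set.InjOn (Quot.mk (Rewrites B)) {a | IsIrreducibleExponent B a} := by
  intro a ha a' ha' h
  obtain ⟨d, had, had'⟩ := hB.join_of_eqvGen (Quot.eqvGen_exact h)
  exact (ha.eq_of_reflTransGen had).symm.trans (ha'.eq_of_reflTransGen had')

theorem eq_of_reflTransGen (hB : IsConvergent ord B) {a₁ a₂ : σ →₀ ℕ}
    (h₁ : ReflTransGen (Rewrites B) a a₁) (h₂ : ReflTransGen (Rewrites B) a a₂)
    (ha₁ : IsIrreducibleExponent B a₁) (ha₂ : IsIrreducibleExponent B a₂) : a₁ = a₂ :=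
  hB.injOn_quotMk ha₁ ha₂ <|
    Quot.eqvGen_sound <| .trans _ _ _ (.symm _ _ (EqvGen.reflTransGen_le_eqvGen _ a a₁ h₁))
      (EqvGen.reflTransGen_le_eqvGen _ a a₂ h₂)

end IsConvergent

end Rewriting

/-! ### Binomials -/

section Binomial

open Relation

variable {σ K : Type*} [Field K] {ord : MonomialOrder σ} {a b c e : σ →₀ ℕ}
  {B : Set ((σ →₀ ℕ) × (σ →₀ ℕ))}

/-- The binomial `X ^ b.1 - X ^ b.2`. -/
noncomputable def binomial (K : Type*) [Field K] (b : (σ →₀ ℕ) × (σ →₀ ℕ)) : MvPolynomial σ K :=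
  MvPolynomial.monomial b.1 1 - MvPolynomial.monomial b.2 1

@[simp]
theorem binomial_self (a : σ →₀ ℕ) : binomial K (a, a) = 0 := sub_self _

theorem neg_binomial (a b : σ →₀ ℕ) : -binomial K (a, b) = binomial K (b, a) := neg_sub _ _

theorem binomial_add_binomial (a b c : σ →₀ ℕ) :
    binomial K (a, b) + binomial K (b, c) = binomial K (a, c) := sub_add_sub_cancel _ _ _

theorem monomial_mul_binomial (u : σ →₀ ℕ) (b : (σ →₀ ℕ) × (σ →₀ ℕ)) :
    MvPolynomial.monomial u 1 * binomial K b = binomial K (u + b.1, u + b.2) := by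
  simp [binomial, mul_sub, MvPolynomial.monomial_mul]

theorem coeff_binomial_fst (h : a ≠ b) : (binomial K (a, b)).coeff a = 1 := by
  classical
  simp [binomial, MvPolynomial.coeff_monomial, h.symm]

theorem mem_support_binomial (h : a ≠ b) : e ∈ (binomial K (a, b)).support ↔ e = a ∨ e = b := by
  classical
  rw [MvPolynomial.mem_support_iff]
  rcases eq_or_ne e a with rfl | hea
  · simp [coeff_binomial_fst h]
  · simp [binomial, MvPolynomial.coeff_monomial, hea.symm, eq_comm]

theorem binomial_eq_zero_iff : binomial K (a, b) = 0 ↔ a = b := by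
  refine ⟨fun h => ?_, fun h => h ▸ binomial_self a⟩
  by_contra hab
  simpa [h] using coeff_binomial_fst (K := K) hab

theorem degree_binomial (h : b ≺[ord] a) : ord.degree (binomial K (a, b)) = a := by
  classical
  rw [binomial, ord.degree_sub_of_lt] <;> simp [ord.degree_monomial, h]

theorem leadingCoeff_binomial (h : b ≺[ord] a) : ord.leadingCoeff (binomial K (a, b)) = 1 := by
  rw [MonomialOrder.leadingCoeff, degree_binomial h, coeff_binomial_fst (by rintro rfl; simp at h)]

theorem makeMonic_binomial (h : b ≺[ord] a) :
    makeMonic ord (binomial K (a, b)) = binomial K (a, b) := by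
  simp [makeMonic, leadingCoeff_binomial h]

theorem makeMonic_binomial_swap (h : b ≺[ord] a) :
    makeMonic ord (binomial K (b, a)) = binomial K (a, b) := by
  rw [← neg_binomial a b, makeMonic, ord.leadingCoeff_neg, leadingCoeff_binomial h]
  simp [inv_neg]

theorem binomial_sPair_mem {I : Ideal (MvPolynomial σ K)} {b c : (σ →₀ ℕ) × (σ →₀ ℕ)}
    (hb : binomial K b ∈ I) (hc : binomial K c ∈ I) : binomial K (sPair b c) ∈ I := by
  have hb' := I.mul_mem_left (.monomial (b.1 ⊔ c.1 - b.1) 1) hb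
  have hc' := I.mul_mem_left (.monomial (b.1 ⊔ c.1 - c.1) 1) hc
  rw [monomial_mul_binomial, tsub_add_cancel_of_le le_sup_left, ← neg_binomial, neg_mem_iff] at hb'
  rw [monomial_mul_binomial, tsub_add_cancel_of_le le_sup_right] at hc'
  exact binomial_add_binomial (K := K) _ _ _ ▸ add_mem hb' hc'

theorem sPolynomial_binomial {b c : (σ →₀ ℕ) × (σ →₀ ℕ)} (hb : b.2 ≺[ord] b.1)
    (hc : c.2 ≺[ord] c.1) :
    ord.sPolynomial (binomial K b) (binomial K c) = binomial K (sPair b c).swap := by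
  rw [MonomialOrder.sPolynomial_def, leadingCoeff_binomial hb, leadingCoeff_binomial hc,
    degree_binomial hb, degree_binomial hc, monomial_mul_binomial, monomial_mul_binomial,
    tsub_add_cancel_of_le le_sup_left, tsub_add_cancel_of_le le_sup_right]
  exact sub_sub_sub_cancel_left _ _ _

/-! ### Normal forms of binomials -/

/-- The sums of the coefficients of a polynomial over the classes of mutually convertible
exponents: they vanish on the ideal generated by the binomials of `B`. -/
noncomputable def classSum (K : Type*) [Field K] (B : Set ((σ →₀ ℕ) × (σ →₀ ℕ))) :
    MvPolynomial σ K →ₗ[K] Quot (Rewrites B) →₀ K :=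
  Finsupp.lmapDomain K K (Quot.mk _) ∘ₗ (MvPolynomial.basisMonomials σ K).repr

theorem classSum_monomial (a : σ →₀ ℕ) (k : K) :
    classSum K B (MvPolynomial.monomial a k) = Finsupp.single (Quot.mk _ a) k :=
  Finsupp.mapDomain_single

theorem classSum_eq_zero_of_mem_span {f : MvPolynomial σ K}
    (hf : f ∈ Ideal.span (binomial K '' B)) : classSum K B f = 0 := by
  suffices h : ∀ r : MvPolynomial σ K, classSum K B (r * f) = 0 by simpa using h 1
  induction hf using Submodule.span_induction with
  | mem g hg =>
    obtain ⟨b, hb, rfl⟩ := hg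
    intro r
    induction r using MvPolynomial.induction_on' with
    | monomial u k =>
      have hclass : (Quot.mk (Rewrites B) (u + b.1)) = Quot.mk _ (u + b.2) :=
        Quot.sound ⟨b, hb, u, rfl, rfl⟩
      rw [binomial, mul_sub, map_sub, MvPolynomial.monomial_mul, MvPolynomial.monomial_mul,
        classSum_monomial, classSum_monomial, hclass, sub_self]
    | add p q hp hq => rw [add_mul, map_add, hp, hq, add_zero]
  | zero => simp
  | add g h _ _ hg hh => intro r; rw [mul_add, map_add, hg, hh, add_zero]
  | smul k g _ hg => intro r; rw [smul_eq_mul, ← mul_assoc]; exact hg _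

theorem eq_zero_of_mem_span_binomial {f : MvPolynomial σ K}
    (hf : f ∈ Ideal.span (binomial K '' B))
    (hinj : Set.InjOn (Quot.mk (Rewrites B)) (f.support : Set (σ →₀ ℕ))) : f = 0 := by
  ext a
  by_cases ha : a ∈ f.support
  · have hcoeff : classSum K B f (Quot.mk _ a) = f.coeff a :=
      Finsupp.mapDomain_apply' _ ((MvPolynomial.basisMonomials σ K).repr f) subset_rfl hinj ha
    rw [← hcoeff, classSum_eq_zero_of_mem_span hf, Finsupp.zero_apply, MvPolynomial.coeff_zero]
  · simpa using ha

theorem sub_mem_span_of_reflTransGen {S : Set (MvPolynomial σ K)} {p q : MvPolynomial σ K}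
    (h : ReflTransGen (ReducesTo ord S) p q) : p - q ∈ Ideal.span S := by
  induction h with
  | refl => simp
  | tail _ h ih =>
    obtain ⟨b, hb, -, e, -, -, rfl⟩ := h
    rw [← sub_add]
    exact add_mem ih (Ideal.mul_mem_left _ _ (Ideal.subset_span hb))

theorem binomial_ne_zero {b : (σ →₀ ℕ) × (σ →₀ ℕ)} (hb : b.2 ≺[ord] b.1) : binomial K b ≠ 0 :=
  fun h => by simp [binomial_eq_zero_iff.1 h] at hb

theorem IsOriented.isIrreducibleExponent_of_mem_support (hB : IsOriented ord B)
    {q : MvPolynomial σ K}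
    (hq : ∀ q', ¬ ReducesTo ord (binomial K '' B) q q') (ha : a ∈ q.support) :
    IsIrreducibleExponent B a := fun b hb hle =>
  hq _ ⟨_, ⟨b, hb, rfl⟩, binomial_ne_zero (hB b hb), a, ha,
    (degree_binomial (K := K) (hB b hb)).symm ▸ hle, rfl⟩

theorem IsConvergent.normalForm_eq (hB : IsConvergent ord B) {p q : MvPolynomial σ K}
    (h : IsNormalForm ord (binomial K '' B) p q) : normalForm ord (binomial K '' B) p = q := by
  classical
  have h' : IsNormalForm ord (binomial K '' B) p (normalForm ord (binomial K '' B) p) :=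
    Classical.epsilon_spec ⟨q, h⟩
  refine sub_eq_zero.1 (eq_zero_of_mem_span_binomial ?_ (hB.injOn_quotMk.mono fun a ha => ?_))
  · simpa using sub_mem (sub_mem_span_of_reflTransGen h.1) (sub_mem_span_of_reflTransGen h'.1)
  · rcases Finset.mem_union.1 (MvPolynomial.support_sub σ _ _ ha) with ha | ha
    · exact hB.isOriented.isIrreducibleExponent_of_mem_support h'.2 ha
    · exact hB.isOriented.isIrreducibleExponent_of_mem_support h.2 ha

theorem ReducesTo.neg {S : Set (MvPolynomial σ K)} {p q : MvPolynomial σ K}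
    (h : ReducesTo ord S p q) : ReducesTo ord S (-p) (-q) := by
  obtain ⟨b, hb, hb0, e, he, hle, rfl⟩ := h
  refine ⟨b, hb, hb0, e, by simpa using he, hle, ?_⟩
  rw [MvPolynomial.coeff_neg, neg_div, map_neg]
  ring

theorem IsOriented.reducesTo_binomial (hB : IsOriented ord B) (h : Rewrites B a b) (hac : a ≠ c) :
    ReducesTo ord (binomial K '' B) (binomial K (a, c)) (binomial K (b, c)) := by
  obtain ⟨d, hd, w, rfl, rfl⟩ := h
  refine ⟨_, ⟨d, hd, rfl⟩, binomial_ne_zero (hB d hd), _,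
    (mem_support_binomial hac).2 (.inl rfl),
    ?_, ?_⟩ <;> rw [degree_binomial (hB d hd)]
  · exact le_add_self
  · rw [coeff_binomial_fst hac, leadingCoeff_binomial (hB d hd), div_one, add_tsub_cancel_right,
      monomial_mul_binomial, ← binomial_add_binomial (w + d.1) (w + d.2) c, add_sub_cancel_left]

theorem IsOriented.reflTransGen_reducesTo_binomial (hB : IsOriented ord B)
    (hc : IsIrreducibleExponent B c) (h : ReflTransGen (Rewrites B) a b) :
    ReflTransGen (ReducesTo ord (binomial K '' B)) (binomial K (a, c)) (binomial K (b, c)) := by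
  induction h using ReflTransGen.head_induction_on with
  | refl => exact .refl
  | head hab _ ih =>
    refine .head (hB.reducesTo_binomial hab ?_) ih
    rintro rfl
    exact hc.not_rewrites hab

theorem isNormalForm_binomial_of_isIrreducibleExponent (hB : IsOriented ord B)
    (ha : IsIrreducibleExponent B a) (hb : IsIrreducibleExponent B b) :
    ∀ q, ¬ ReducesTo ord (binomial K '' B) (binomial K (a, b)) q := by
  rintro _ ⟨_, ⟨d, hd, rfl⟩, -, e, he, hle, -⟩
  rw [degree_binomial (hB d hd)] at hle
  have hab : a ≠ b := by rintro rfl; simp at he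
  rcases (mem_support_binomial hab).1 he with rfl | rfl
  · exact ha d hd hle
  · exact hb d hd hle

theorem IsConvergent.isNormalForm_binomial (hB : IsConvergent ord B) {a' c' : σ →₀ ℕ}
    (haa' : ReflTransGen (Rewrites B) a a') (hcc' : ReflTransGen (Rewrites B) c c')
    (ha' : IsIrreducibleExponent B a') (hc' : IsIrreducibleExponent B c') :
    IsNormalForm ord (binomial K '' B) (binomial K (a, c)) (binomial K (a', c')) := by
  refine ⟨?_, isNormalForm_binomial_of_isIrreducibleExponent hB.isOriented ha' hc'⟩
  induction haa' using ReflTransGen.head_induction_on with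
  | refl =>
    rw [← neg_binomial, ← neg_binomial c']
    exact ReflTransGen.lift _ (fun _ _ => ReducesTo.neg) _ _
      (hB.isOriented.reflTransGen_reducesTo_binomial ha' hcc')
  | @head a b hab hba' ih =>
    rcases eq_or_ne a c with rfl | hac
    · rw [hB.eq_of_reflTransGen (.head hab hba') hcc' ha' hc', binomial_self, binomial_self]
    · exact .head (hB.isOriented.reducesTo_binomial hab hac) ih

/-! ### Standard representations -/

/-- The polynomials that are sums of multiples of elements of `S` of degree at most `e`. -/
noncomputable def repsUpTo (ord : MonomialOrder σ) (S : Set (MvPolynomial σ K)) (e : σ →₀ ℕ) :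
    Submodule K (MvPolynomial σ K) :=
  Submodule.span K {p | ∃ g ∈ S, ∃ q, p = q * g ∧ ord.degree p ≼[ord] e}

theorem hasStdRep_of_mem_repsUpTo {S : Set (MvPolynomial σ K)} {p : MvPolynomial σ K}
    (h : p ∈ repsUpTo ord S (ord.degree p)) : HasStdRep ord S p := by
  obtain ⟨n, k, g, hp⟩ := Submodule.mem_span_set'.1 h
  choose q hq c hc hdeg using fun i => (g i).2
  refine .inr ⟨n, fun i => k i • c i, q, hq, ?_, fun i _ => ?_⟩
  · simp only [← hp, hc, smul_mul_assoc]
  · rw [smul_mul_assoc, ← hc]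
    exact ord.degree_smul_le.trans (hdeg i)

theorem IsOriented.binomial_mem_repsUpTo (hB : IsOriented ord B)
    (h : ReflTransGen (Rewrites B) a b) (hae : a ≼[ord] e) :
    binomial K (a, b) ∈ repsUpTo ord (binomial K '' B) e := by
  induction h using ReflTransGen.head_induction_on with
  | refl => simp
  | @head a a' haa' _ ih =>
    have hlt := hB.lt_of_rewrites haa'
    rw [← binomial_add_binomial (K := K) a a' b]
    refine add_mem (Submodule.subset_span ?_) (ih (hlt.le.trans hae))
    obtain ⟨d, hd, w, rfl, rfl⟩ := haa'
    exact ⟨_, ⟨d, hd, rfl⟩, _, (monomial_mul_binomial w d).symm,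
      (degree_binomial (K := K) hlt).symm ▸ hae⟩

theorem IsOriented.hasStdRep_binomial (hB : IsOriented ord B)
    (h : Join (ReflTransGen (Rewrites B)) a b) :
    HasStdRep ord (binomial K '' B) (binomial K (a, b)) := by
  obtain ⟨d, had, hbd⟩ := h
  rcases eq_or_ne a b with rfl | hab
  · exact .inl (binomial_self a)
  have hdeg : ∀ c, c = a ∨ c = b → c ≼[ord] ord.degree (binomial K (a, b)) := fun c hc =>
    ord.le_degree ((mem_support_binomial hab).2 hc)
  have hsub := sub_mem (hB.binomial_mem_repsUpTo (K := K) had (hdeg a (.inl rfl)))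
    (hB.binomial_mem_repsUpTo hbd (hdeg b (.inr rfl)))
  rw [sub_eq_add_neg, neg_binomial, binomial_add_binomial] at hsub
  exact hasStdRep_of_mem_repsUpTo hsub

theorem IsOriented.isGroebnerUpTo_binomial (hB : IsOriented ord B) (hfin : B.Finite) {d : ℕ}
    (hjoin : ∀ b ∈ B, ∀ c ∈ B, (sPair b c).1.degree ≤ d →
      Join (ReflTransGen (Rewrites B)) (sPair b c).1 (sPair b c).2) :
    IsGroebnerUpTo ord d (binomial K '' B) (Ideal.span (binomial K '' B)) := by
  refine ⟨hfin.image _, rfl, ?_⟩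
  rintro _ ⟨b, hb, rfl⟩ _ ⟨c, hc, rfl⟩ hle
  rw [sPolynomial_binomial (hB b hb) (hB c hc), Prod.swap] at hle ⊢
  rcases eq_or_ne (sPair b c).2 (sPair b c).1 with h | h
  · exact .inl (binomial_eq_zero_iff.2 h)
  · refine hB.hasStdRep_binomial (Join.symm.symm _ _ (hjoin b hb c hc ?_))
    exact (MvPolynomial.le_totalDegree ((mem_support_binomial h).2 (.inr rfl))).trans hle

theorem headIdeal_union_eq {S T : Set (MvPolynomial σ K)}
    (h : ∀ q ∈ T, q ≠ 0 → ∃ p ∈ S, p ≠ 0 ∧ ord.degree p ≤ ord.degree q) :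
    headIdeal ord (S ∪ T) = headIdeal ord S := by
  refine le_antisymm (Ideal.span_le.2 ?_) (Ideal.span_mono ?_)
  · rintro _ ⟨q, hq | hq, hq0, rfl⟩
    · exact Ideal.subset_span ⟨q, hq, hq0, rfl⟩
    · obtain ⟨p, hp, hp0, hle⟩ := h q hq hq0
      refine Ideal.mem_of_dvd _ ?_ (Ideal.subset_span ⟨p, hp, hp0, rfl⟩)
      exact MvPolynomial.monomial_one_dvd_monomial_one.2 hle
  · rintro _ ⟨p, hp, hp0, rfl⟩
    exact ⟨p, .inl hp, hp0, rfl⟩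

end Binomial

/-! ### Labeled polynomials -/

namespace F5

variable {σ K : Type*} [Field K] {m : ℕ} {ord : MonomialOrder σ}

theorem polys_append (G H : List (LabeledPoly σ K m)) : polys (G ++ H) = polys G ∪ polys H := by
  ext p
  simp [polys, or_and_right, exists_or]

theorem reduction_eq_some {i : Fin (m + 1)} {G : List (LabeledPoly σ K m)} {s t : RedState σ K m}
    {k : ℕ} (ht : (reductionStep ord i G)^[k] s = t) (htodo : t.todo = []) :
    reduction ord i G s = some t := by
  have hex : ∃ n, ((reductionStep ord i G)^[n] s).todo = [] := ⟨k, ht ▸ htodo⟩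
  rw [reduction, dif_pos hex, ← ht]
  obtain ⟨l, hl⟩ := Nat.exists_eq_add_of_le' (Nat.find_min' hex (ht ▸ htodo))
  have hfix : reductionStep ord i G ((reductionStep ord i G)^[Nat.find hex] s) =
      (reductionStep ord i G)^[Nat.find hex] s := by
    rw [reductionStep, Nat.find_spec hex]
  rw [hl, Function.iterate_add_apply, Function.iterate_fixed hfix]

end F5

/-! ### Exponent vectors as functions -/

namespace BinomialF5

open Relation

variable {n m : ℕ}

/-- Exponent vectors in a form that the kernel can compute with. -/
abbrev Exponent (n : ℕ) := Fin n → ℕ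

/-- The binomial `X ^ p.1 - X ^ p.2`, whose coefficients do not depend on the field. -/
abbrev Binomial (n : ℕ) := Exponent n × Exponent n

instance : DecidableLE (Exponent n) := fun a b => inferInstanceAs (Decidable (∀ i, a i ≤ b i))

/-- The exponent vector `a` as an index of monomials. -/
noncomputable def Exponent.toFinsupp (a : Exponent n) : Fin n →₀ ℕ :=
  Finsupp.equivFunOnFinite.symm a

namespace Exponent

variable {a b : Exponent n}

theorem toFinsupp_injective : Function.Injective (toFinsupp (n := n)) := Equiv.injective _

@[simp]
theorem toFinsupp_inj : a.toFinsupp = b.toFinsupp ↔ a = b := toFinsupp_injective.eq_iff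

theorem toFinsupp_zero : toFinsupp (0 : Exponent n) = 0 := by
  ext; rfl

theorem toFinsupp_add (a b : Exponent n) : (a + b).toFinsupp = a.toFinsupp + b.toFinsupp := by
  ext; rfl

theorem toFinsupp_sub (a b : Exponent n) : (a - b).toFinsupp = a.toFinsupp - b.toFinsupp := by
  ext; rfl

theorem toFinsupp_sup (a b : Exponent n) : (a ⊔ b).toFinsupp = a.toFinsupp ⊔ b.toFinsupp := by
  ext; rfl

@[simp]
theorem toFinsupp_le_toFinsupp : a.toFinsupp ≤ b.toFinsupp ↔ a ≤ b := Iff.rfl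

theorem degree_toFinsupp (a : Exponent n) : a.toFinsupp.degree = ∑ i, a i :=
  Finsupp.degree_eq_sum _

end Exponent

/-- The degree reverse lexicographical ordering. -/
def Precedes (a b : Exponent n) : Prop :=
  ∑ i, a i < ∑ i, b i ∨
    ∑ i, a i = ∑ i, b i ∧ ∃ i, (∀ j, i < j → a j = b j) ∧ b i < a i
deriving Decidable

theorem precedes_iff {a b : Exponent n} :
    Precedes a b ↔ a.toFinsupp ≺[degRevLex n] b.toFinsupp := by
  rw [degRevLex_lt_iff, Exponent.degree_toFinsupp, Exponent.degree_toFinsupp]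
  rfl

theorem precedes_of_not_precedes {a b : Exponent n} (hne : a ≠ b) (h : ¬ Precedes a b) :
    Precedes b a := by
  rw [precedes_iff] at h ⊢
  exact (not_lt.1 h).lt_of_ne fun h' =>
    hne.symm (Exponent.toFinsupp_injective ((degRevLex n).toSyn.injective h'))

/-- The exponent vectors of `p` as indices of monomials. -/
noncomputable def Binomial.toFinsupp (p : Binomial n) : (Fin n →₀ ℕ) × (Fin n →₀ ℕ) :=
  p.map Exponent.toFinsupp Exponent.toFinsupp

/-- The exponent of the head term; it is `0` for `p.1 = p.2`, as for `MonomialOrder.degree`. -/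
def Binomial.headExponent (p : Binomial n) : Exponent n :=
  if p.1 = p.2 then 0 else if Precedes p.1 p.2 then p.2 else p.1

/-- The binomial divided by its head coefficient, which is `1` or `-1`. -/
def Binomial.monic (p : Binomial n) : Binomial n := if Precedes p.1 p.2 then p.swap else p

namespace Binomial

variable {K : Type*} [Field K]

theorem toFinsupp_sPair (b c : Binomial n) :
    toFinsupp (sPair b c) = sPair b.toFinsupp c.toFinsupp := by
  simp only [toFinsupp, sPair, Prod.map, Exponent.toFinsupp_add, Exponent.toFinsupp_sub,
    Exponent.toFinsupp_sup]

theorem degree_binomial_toFinsupp (p : Binomial n) :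
    (degRevLex n).degree (binomial K p.toFinsupp) = p.headExponent.toFinsupp := by
  obtain ⟨a, b⟩ := p
  simp only [headExponent, toFinsupp, Prod.map_apply]
  split_ifs with hne h
  · rw [hne, binomial_self, MonomialOrder.degree_zero, Exponent.toFinsupp_zero]
  · rw [← neg_binomial, MonomialOrder.degree_neg, degree_binomial (precedes_iff.1 h)]
  · exact degree_binomial (precedes_iff.1 (precedes_of_not_precedes hne h))

theorem makeMonic_binomial_toFinsupp {p : Binomial n} (hne : p.1 ≠ p.2) :
    makeMonic (degRevLex n) (binomial K p.toFinsupp) = binomial K p.monic.toFinsupp := by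
  obtain ⟨a, b⟩ := p
  rw [monic]
  split_ifs with h
  · exact makeMonic_binomial_swap (precedes_iff.1 h)
  · exact makeMonic_binomial (precedes_iff.1 (precedes_of_not_precedes hne h))

end Binomial

/-- The rules `b.1 ↦ b.2` for `b` in a list. -/
def ruleSet (B : List (Binomial n)) : Set ((Fin n →₀ ℕ) × (Fin n →₀ ℕ)) :=
  Binomial.toFinsupp '' {b | b ∈ B}

/-- The result of rewriting `a` by `b.1 ↦ b.2` for `b ∈ B` as long as possible; it is `none` if
`k` passes do not suffice. -/
def normalExponent (B : List (Binomial n)) : ℕ → Exponent n → Option (Exponent n)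
  | 0, _ => none
  | k + 1, a =>
    match B.find? fun b => b.1 ≤ a with
    | none => some a
    | some b => normalExponent B k (a - b.1 + b.2)

/-- Rewriting with at most `k` passes joins the two exponents of `p`. -/
def JoinableWithin (B : List (Binomial n)) (k : ℕ) (p : Binomial n) : Prop :=
  ∃ a ∈ normalExponent B k p.1, normalExponent B k p.2 = some a
deriving Decidable

/-- A bound for the number of rewriting steps that is large enough for the example below. -/
abbrev fuel : ℕ := 20

/-- The binomials in `B` form a Gröbner basis of the ideal they generate, by Buchberger's criterion
with at most `fuel` passes of rewriting for each s-polynomial. -/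
def IsGroebner (B : List (Binomial n)) : Prop :=
  (∀ b ∈ B, Precedes b.2 b.1) ∧ ∀ b ∈ B, ∀ c ∈ B, JoinableWithin B fuel (sPair b c)
deriving Decidable

section Rewriting

variable {B : List (Binomial n)} {k : ℕ}

theorem reflTransGen_and_isIrreducibleExponent_of_mem_normalExponent {a a' : Exponent n}
    (h : a' ∈ normalExponent B k a) :
    ReflTransGen (Rewrites (ruleSet B)) a.toFinsupp a'.toFinsupp ∧
      IsIrreducibleExponent (ruleSet B) a'.toFinsupp := by
  induction k generalizing a with
  | zero => simp [normalExponent] at h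
  | succ k ih =>
    rw [normalExponent] at h
    split at h
    · rename_i hnone
      obtain rfl := Option.some_inj.1 h
      refine ⟨.refl, ?_⟩
      rintro _ ⟨b, hb, rfl⟩ hle
      exact List.find?_eq_none.1 hnone b hb (decide_eq_true (Exponent.toFinsupp_le_toFinsupp.1 hle))
    · rename_i b hb
      have hle : b.1 ≤ a := by simpa using List.find?_some hb
      refine (ih h).imp_left (.head ?_)
      rw [Exponent.toFinsupp_add, Exponent.toFinsupp_sub]
      exact rewrites_sub_add (b := b.toFinsupp) ⟨b, List.mem_of_find?_eq_some hb, rfl⟩ hle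

theorem JoinableWithin.join {p : Binomial n} (h : JoinableWithin B k p) :
    Join (ReflTransGen (Rewrites (ruleSet B))) p.1.toFinsupp p.2.toFinsupp := by
  obtain ⟨a, h₁, h₂⟩ := h
  exact ⟨a.toFinsupp, (reflTransGen_and_isIrreducibleExponent_of_mem_normalExponent h₁).1,
    (reflTransGen_and_isIrreducibleExponent_of_mem_normalExponent h₂).1⟩

theorem isOriented_ruleSet (h : ∀ b ∈ B, Precedes b.2 b.1) :
    IsOriented (degRevLex n) (ruleSet B) := by
  rintro _ ⟨b, hb, rfl⟩
  exact precedes_iff.1 (h b hb)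

theorem IsGroebner.isConvergent (h : IsGroebner B) :
    IsConvergent (degRevLex n) (ruleSet B) where
  isOriented := isOriented_ruleSet h.1
  join_sPair := by
    rintro _ ⟨b, hb, rfl⟩ _ ⟨c, hc, rfl⟩
    rw [← Binomial.toFinsupp_sPair]
    exact (h.2 b hb c hc).join

theorem IsGroebner.normalForm_binomial {K : Type*} [Field K] (h : IsGroebner B)
    {p : Binomial n} {a b : Exponent n} (ha : a ∈ normalExponent B k p.1)
    (hb : b ∈ normalExponent B k p.2) :
    normalForm (degRevLex n) (binomial K '' ruleSet B) (binomial K p.toFinsupp) =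
      binomial K (Binomial.toFinsupp (a, b)) :=
  have ha' := reflTransGen_and_isIrreducibleExponent_of_mem_normalExponent ha
  have hb' := reflTransGen_and_isIrreducibleExponent_of_mem_normalExponent hb
  h.isConvergent.normalForm_eq (h.isConvergent.isNormalForm_binomial ha'.1 hb'.1 ha'.2 hb'.2)

end Rewriting

/-! ### Labeled binomials and critical pairs -/

/-- The counterpart of `F5.Signature`. -/
structure Signature (n m : ℕ) where
  term : Exponent n
  idx : Fin (m + 1)
deriving DecidableEq

/-- The counterpart of `F5.Signature.Lt`. -/
def Signature.Lt (s t : Signature n m) : Prop :=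
  t.idx < s.idx ∨ s.idx = t.idx ∧ Precedes s.term t.term
deriving Decidable

/-- The counterpart of `F5.Signature.shift`. -/
def Signature.shift (u : Exponent n) (s : Signature n m) : Signature n m := ⟨u + s.term, s.idx⟩

/-- The counterpart of `F5.LabeledPoly`. -/
structure LabeledBinomial (n m : ℕ) where
  num : ℕ
  sig : Signature n m
  bin : Binomial n

/-- The counterpart of `F5.LabeledPoly.ht`. -/
def LabeledBinomial.ht (r : LabeledBinomial n m) : Exponent n := r.bin.headExponent

/-- The counterpart of `F5.Rules`. -/
abbrev Rules (n m : ℕ) := List (Signature n m × ℕ)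

/-- The counterpart of `F5.FaugereDetected`. -/
def FaugereDetected (G : List (LabeledBinomial n m)) (u : Exponent n) (r : LabeledBinomial n m) :
    Prop :=
  ∃ g ∈ G, r.sig.idx < g.sig.idx ∧ g.ht ≤ u + r.sig.term
deriving Decidable

/-- The counterpart of `F5.Rewritten`. -/
def Rewritten (rules : Rules n m) (u : Exponent n) (r : LabeledBinomial n m) : Prop :=
  ∃ a ∈ rules, a.1.idx = r.sig.idx ∧ r.num < a.2 ∧ a.1.term ≤ u + r.sig.term
deriving Decidable

/-- The counterpart of `F5.CritPair`. -/
structure CritPair (n m : ℕ) where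
  lcm : Exponent n
  u₁ : Exponent n
  r₁ : LabeledBinomial n m
  u₂ : Exponent n
  r₂ : LabeledBinomial n m

/-- The counterpart of `F5.CritPair.deg`. -/
def CritPair.deg (p : CritPair n m) : ℕ := ∑ i, p.lcm i

/-- The counterpart of `F5.orientedPair`. -/
def orientedPair (r s : LabeledBinomial n m) : CritPair n m :=
  let t := r.ht ⊔ s.ht
  let u := t - r.ht
  let v := t - s.ht
  if (r.sig.shift u).Lt (s.sig.shift v) then ⟨t, v, s, u, r⟩ else ⟨t, u, r, v, s⟩

/-- The counterpart of `F5.critPair`. -/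
def critPair (i : Fin (m + 1)) (G : List (LabeledBinomial n m)) (r s : LabeledBinomial n m) :
    Option (CritPair n m) :=
  let p := orientedPair r s
  if i < p.r₁.sig.idx then none
  else if FaugereDetected G p.u₁ p.r₁ then none
  else if p.r₂.sig.idx = i ∧ FaugereDetected G p.u₂ p.r₂ then none
  else some p

/-- The counterpart of `F5.insertBySig`. -/
def insertBySig (r : LabeledBinomial n m) (l : List (LabeledBinomial n m)) :
    List (LabeledBinomial n m) :=
  l.orderedInsert (fun a b => a.sig = b.sig ∨ a.sig.Lt b.sig) r

noncomputable section

variable (K : Type*) [Field K]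

/-- The signature represented by `s`. -/
def Signature.toF5 (s : Signature n m) : F5.Signature (Fin n) m := ⟨s.term.toFinsupp, s.idx⟩

/-- The labeled polynomial represented by `r`. -/
def LabeledBinomial.toF5 (r : LabeledBinomial n m) : F5.LabeledPoly (Fin n) K m :=
  ⟨r.num, r.sig.toF5, binomial K r.bin.toFinsupp⟩

/-- The list of rules represented by `rules`. -/
def Rules.toF5 (rules : Rules n m) : F5.Rules (Fin n) m := rules.map (Prod.map Signature.toF5 id)

/-- The critical pair represented by `p`. -/
def CritPair.toF5 (p : CritPair n m) : F5.CritPair (Fin n) K m :=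
  ⟨p.lcm.toFinsupp, p.u₁.toFinsupp, p.r₁.toF5 K, p.u₂.toFinsupp, p.r₂.toF5 K⟩

end

section Correctness

variable {K : Type*} [Field K]

theorem Signature.toF5_injective : Function.Injective (toF5 (n := n) (m := m)) := by
  rintro ⟨a, i⟩ ⟨b, j⟩ h
  simpa [toF5] using h

theorem Signature.lt_toF5 {s t : Signature n m} :
    s.toF5.Lt (degRevLex n) t.toF5 ↔ s.Lt t := by
  simp only [F5.Signature.Lt, toF5, Signature.Lt, precedes_iff]

theorem Signature.shift_toF5 (u : Exponent n) (s : Signature n m) :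
    s.toF5.shift u.toFinsupp = (s.shift u).toF5 := by
  simp only [F5.Signature.shift, toF5, shift, Exponent.toFinsupp_add]

theorem LabeledBinomial.ht_toF5 (r : LabeledBinomial n m) :
    (r.toF5 K).ht (degRevLex n) = r.ht.toFinsupp :=
  r.bin.degree_binomial_toFinsupp

theorem CritPair.deg_toF5 (p : CritPair n m) : (p.toF5 K).deg = p.deg :=
  Exponent.degree_toFinsupp _

theorem LabeledBinomial.shift_sig_toF5 (u : Exponent n) (r : LabeledBinomial n m) :
    (r.toF5 K).sig.shift u.toFinsupp = (r.sig.shift u).toF5 :=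
  r.sig.shift_toF5 u

theorem faugereDetected_toF5 {G : List (LabeledBinomial n m)} {u : Exponent n}
    {r : LabeledBinomial n m} :
    F5.FaugereDetected (degRevLex n) (G.map (LabeledBinomial.toF5 K)) u.toFinsupp (r.toF5 K) ↔
      FaugereDetected G u r := by
  simp only [F5.FaugereDetected, FaugereDetected, List.mem_map, exists_exists_and_eq_and,
    LabeledBinomial.ht_toF5]
  rfl

theorem rewritten_toF5 {rules : Rules n m} {u : Exponent n} {r : LabeledBinomial n m} :
    F5.Rewritten rules.toF5 u.toFinsupp (r.toF5 K) ↔ Rewritten rules u r := by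
  simp only [F5.Rewritten, Rewritten, Rules.toF5, List.mem_map, exists_exists_and_eq_and]
  rfl

theorem orientedPair_toF5 (r s : LabeledBinomial n m) :
    F5.orientedPair (degRevLex n) (r.toF5 K) (s.toF5 K) = (orientedPair r s).toF5 K := by
  simp only [F5.orientedPair, orientedPair, LabeledBinomial.ht_toF5, ← Exponent.toFinsupp_sup,
    ← Exponent.toFinsupp_sub, LabeledBinomial.shift_sig_toF5, Signature.lt_toF5]
  split_ifs <;> rfl

theorem critPair_toF5 (i : Fin (m + 1)) (G : List (LabeledBinomial n m))
    (r s : LabeledBinomial n m) :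
    F5.critPair (degRevLex n) i (G.map (LabeledBinomial.toF5 K)) (r.toF5 K) (s.toF5 K) =
      (critPair i G r s).map (CritPair.toF5 K) := by
  rw [F5.critPair, critPair, orientedPair_toF5]
  generalize orientedPair r s = p
  have hidx₁ : (p.toF5 K).r₁.sig.idx = p.r₁.sig.idx := rfl
  have hidx₂ : (p.toF5 K).r₂.sig.idx = p.r₂.sig.idx := rfl
  have hdet₁ : F5.FaugereDetected (degRevLex n) (G.map (LabeledBinomial.toF5 K))
      (p.toF5 K).u₁ (p.toF5 K).r₁ ↔ FaugereDetected G p.u₁ p.r₁ := faugereDetected_toF5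
  have hdet₂ : F5.FaugereDetected (degRevLex n) (G.map (LabeledBinomial.toF5 K))
      (p.toF5 K).u₂ (p.toF5 K).r₂ ↔ FaugereDetected G p.u₂ p.r₂ := faugereDetected_toF5
  simp only [hidx₁, hidx₂, hdet₁, hdet₂]
  split_ifs <;> rfl

theorem filterMap_critPair_toF5 (i : Fin (m + 1)) (G : List (LabeledBinomial n m))
    (r : LabeledBinomial n m) :
    (G.map (LabeledBinomial.toF5 K)).filterMap
        (F5.critPair (degRevLex n) i (G.map (LabeledBinomial.toF5 K)) (r.toF5 K)) =
      (G.filterMap (critPair i G r)).map (CritPair.toF5 K) := by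
  rw [List.filterMap_map, List.map_filterMap]
  exact List.filterMap_congr fun s _ => critPair_toF5 i G r s

theorem insertBySig_toF5 (r : LabeledBinomial n m) (l : List (LabeledBinomial n m)) :
    F5.insertBySig (degRevLex n) (r.toF5 K) (l.map (LabeledBinomial.toF5 K)) =
      (insertBySig r l).map (LabeledBinomial.toF5 K) := by
  have hle (a b : LabeledBinomial n m) :
      (a.sig = b.sig ∨ a.sig.Lt b.sig) ↔ (a.toF5 K).sig.Le (degRevLex n) (b.toF5 K).sig :=
    or_congr Signature.toF5_injective.eq_iff.symm Signature.lt_toF5.symm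
  classical exact (List.map_orderedInsert _ _ _ _ _ (fun a _ => hle a r) fun a _ => hle r a).symm

end Correctness

/-! ### Reduction -/

/-- The counterpart of `F5.RedState`, without `zeros`. -/
structure RedState (n m : ℕ) where
  todo : List (LabeledBinomial n m)
  done : List (LabeledBinomial n m)
  count : ℕ
  rules : Rules n m

/-- The s-polynomial of `p` with the number `k`, for a pair whose heads cancel. -/
def CritPair.spol (p : CritPair n m) (k : ℕ) : LabeledBinomial n m :=
  ⟨k, p.r₁.sig.shift p.u₁, (p.u₂ + p.r₂.bin.2, p.u₁ + p.r₁.bin.2)⟩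

/-- The counterpart of `F5.spol`; it is `none` if the heads of some s-polynomial do not cancel, so
that it need not be a binomial. -/
def spol : List (CritPair n m) → RedState n m → Option (RedState n m)
  | [], s => some s
  | p :: ps, s =>
    if Rewritten s.rules p.u₁ p.r₁ ∨ Rewritten s.rules p.u₂ p.r₂ then spol ps s
    else if p.u₁ + p.r₁.bin.1 = p.u₂ + p.r₂.bin.1 then
      let r := p.spol s.count
      spol ps
        { s with
          todo := insertBySig r s.todo
          count := s.count + 1
          rules := (r.sig, r.num) :: s.rules }
    else none

/-- The counterpart of `F5.IsReducer`. -/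
def IsReducer (i : Fin (m + 1)) (G : List (LabeledBinomial n m)) (rules : Rules n m)
    (r g : LabeledBinomial n m) : Prop :=
  g.sig.idx = i ∧ g.ht ≤ r.ht ∧ ¬ FaugereDetected G (r.ht - g.ht) g ∧
    ¬ Rewritten rules (r.ht - g.ht) g ∧ g.sig.shift (r.ht - g.ht) ≠ r.sig
deriving Decidable

/-- The counterpart of `F5.polysAbove`. -/
def binsAbove (i : Fin (m + 1)) (G : List (LabeledBinomial n m)) : List (Binomial n) :=
  (G.filter (i < ·.sig.idx)).map (·.bin)

/-- The counterpart of `F5.reductionStep` when `binsAbove i G` is a Gröbner basis; it is `none` if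
the first element of `todo` is reduced to zero or has a reducer. -/
def reductionStep (i : Fin (m + 1)) (G : List (LabeledBinomial n m)) (s : RedState n m) :
    Option (RedState n m) :=
  match s.todo with
  | [] => some s
  | r :: rest => do
    let a ← normalExponent (binsAbove i G) fuel r.bin.1
    let b ← normalExponent (binsAbove i G) fuel r.bin.2
    if a ≠ b ∧
        ∀ g ∈ G ++ s.done, ¬ IsReducer i (G ++ s.done) s.rules { r with bin := (a, b) } g then
      some { s with
        todo := rest
        done := s.done ++ [{ r with bin := Binomial.monic (a, b) }] }
    else none

/-- The counterpart of `F5.reduction`, with a bound for the number of passes. -/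
def reduction (i : Fin (m + 1)) (G : List (LabeledBinomial n m)) :
    ℕ → RedState n m → Option (RedState n m)
  | 0, s => if s.todo.isEmpty then some s else none
  | k + 1, s => (reductionStep i G s).bind (reduction i G k)

/-- The data of a call of `Reduction` represented by `s`; nothing has been reduced to zero. -/
noncomputable def RedState.toF5 (K : Type*) [Field K] (s : RedState n m) :
    F5.RedState (Fin n) K m :=
  ⟨s.todo.map (LabeledBinomial.toF5 K), s.done.map (LabeledBinomial.toF5 K), s.count,
    s.rules.toF5, []⟩

section Correctness

variable {K : Type*} [Field K]

theorem CritPair.spol_toF5 {p : CritPair n m} (k : ℕ)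
    (h : p.u₁ + p.r₁.bin.1 = p.u₂ + p.r₂.bin.1) :
    (⟨k, (p.toF5 K).r₁.sig.shift (p.toF5 K).u₁,
      MvPolynomial.monomial (p.toF5 K).u₁ 1 * (p.toF5 K).r₁.poly -
        MvPolynomial.monomial (p.toF5 K).u₂ 1 * (p.toF5 K).r₂.poly⟩ : F5.LabeledPoly (Fin n) K m) =
      (p.spol k).toF5 K := by
  simp only [spol, toF5, LabeledBinomial.toF5, Signature.shift_toF5, Binomial.toFinsupp, Prod.map,
    monomial_mul_binomial, ← Exponent.toFinsupp_add, h]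
  simp only [binomial, sub_sub_sub_cancel_left]

theorem spol_toF5 {l : List (CritPair n m)} {s t : RedState n m} (h : spol l s = some t) :
    F5.spol (degRevLex n) (l.map (CritPair.toF5 K)) (s.toF5 K) = t.toF5 K := by
  induction l generalizing s with
  | nil => exact congrArg (RedState.toF5 K) (Option.some_inj.1 h)
  | cons p ps ih =>
    have hrew₁ : F5.Rewritten (s.toF5 K).rules (p.toF5 K).u₁ (p.toF5 K).r₁ ↔
      Rewritten s.rules p.u₁ p.r₁ := rewritten_toF5
    have hrew₂ : F5.Rewritten (s.toF5 K).rules (p.toF5 K).u₂ (p.toF5 K).r₂ ↔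
      Rewritten s.rules p.u₂ p.r₂ := rewritten_toF5
    rw [spol] at h
    simp only [List.map_cons, F5.spol, hrew₁, hrew₂]
    split_ifs at h ⊢ with hrew hheads
    · exact ih h
    · have hsig : (p.toF5 K).r₁.sig.shift (p.toF5 K).u₁ = (p.spol s.count).sig.toF5 :=
        p.r₁.shift_sig_toF5 p.u₁
      rw [← ih h, CritPair.spol_toF5 _ hheads, hsig]
      simp only [RedState.toF5, insertBySig_toF5]
      rfl

theorem isReducer_toF5 {i : Fin (m + 1)} {G : List (LabeledBinomial n m)} {rules : Rules n m}
    {r g : LabeledBinomial n m} :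
    F5.IsReducer (degRevLex n) i (G.map (LabeledBinomial.toF5 K)) rules.toF5 (r.toF5 K)
      (g.toF5 K) ↔ IsReducer i G rules r g := by
  have hsig (s : Signature n m) : s.toF5 ≠ (r.toF5 K).sig ↔ s ≠ r.sig :=
    Signature.toF5_injective.ne_iff
  simp only [F5.IsReducer, IsReducer, LabeledBinomial.ht_toF5, ← Exponent.toFinsupp_sub,
    faugereDetected_toF5, rewritten_toF5, LabeledBinomial.shift_sig_toF5, hsig,
    Exponent.toFinsupp_le_toFinsupp]
  rfl

theorem polys_toF5 (G : List (LabeledBinomial n m)) :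
    F5.polys (G.map (LabeledBinomial.toF5 K)) = binomial K '' ruleSet (G.map (·.bin)) := by
  ext p
  simp [F5.polys, ruleSet, LabeledBinomial.toF5]

theorem polysAbove_toF5 (i : Fin (m + 1)) (G : List (LabeledBinomial n m)) :
    F5.polysAbove i (G.map (LabeledBinomial.toF5 K)) = binomial K '' ruleSet (binsAbove i G) := by
  rw [binsAbove, ← polys_toF5]
  ext p
  simp [F5.polys, F5.polysAbove, LabeledBinomial.toF5, Signature.toF5, and_assoc]

theorem reductionStep_toF5 {i : Fin (m + 1)} {G : List (LabeledBinomial n m)}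
    {s t : RedState n m} (hB : IsGroebner (binsAbove i G)) (h : reductionStep i G s = some t) :
    F5.reductionStep (degRevLex n) i (G.map (LabeledBinomial.toF5 K)) (s.toF5 K) = t.toF5 K := by
  obtain ⟨_ | ⟨r, rest⟩, done, count, rules⟩ := s
  · exact congrArg (RedState.toF5 K) (Option.some_inj.1 h)
  simp only [reductionStep, Option.bind_eq_bind, Option.bind_eq_some_iff] at h
  obtain ⟨a, ha, b, hb, h⟩ := h
  split_ifs at h with hcond
  obtain ⟨hne, hred⟩ := hcond
  obtain rfl := Option.some_inj.1 h
  set r' : LabeledBinomial n m := { r with bin := (a, b) }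
  have hnf : normalForm (degRevLex n) (F5.polysAbove i (G.map (LabeledBinomial.toF5 K)))
      (r.toF5 K).poly = (r'.toF5 K).poly := by
    rw [polysAbove_toF5]
    exact hB.normalForm_binomial ha hb
  have hzero : (r'.toF5 K).poly ≠ 0 :=
    mt binomial_eq_zero_iff.1 (mt Exponent.toFinsupp_inj.1 hne)
  have hfind : F5.findReducer (degRevLex n) i
      (G.map (LabeledBinomial.toF5 K) ++ done.map (LabeledBinomial.toF5 K)) rules.toF5
      (r'.toF5 K) = none := by
    rw [← List.map_append, F5.findReducer, List.find?_eq_none]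
    simp only [List.forall_mem_map, decide_eq_true_eq, isReducer_toF5]
    exact hred
  have hmonic : makeMonic (degRevLex n) (r'.toF5 K).poly =
      binomial K (Binomial.monic (a, b)).toFinsupp := Binomial.makeMonic_binomial_toFinsupp hne
  simp only [F5.reductionStep, RedState.toF5, List.map_cons, hnf]
  change F5.topReduction _ _ _ (r'.toF5 K) _ = _
  simp only [F5.topReduction, if_neg hzero, hfind, hmonic, List.map_append]
  rfl

theorem iterate_reductionStep_toF5 {i : Fin (m + 1)} {G : List (LabeledBinomial n m)} {k : ℕ}
    {s t : RedState n m} (hB : IsGroebner (binsAbove i G)) (h : reduction i G k s = some t) :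
    (F5.reductionStep (degRevLex n) i (G.map (LabeledBinomial.toF5 K)))^[k] (s.toF5 K) =
      t.toF5 K ∧ t.todo = [] := by
  induction k generalizing s with
  | zero =>
    rw [reduction] at h
    split_ifs at h with htodo
    obtain rfl := Option.some_inj.1 h
    exact ⟨rfl, List.isEmpty_iff.1 htodo⟩
  | succ k ih =>
    obtain ⟨s', hs', h⟩ := Option.bind_eq_some_iff.1 h
    rw [Function.iterate_succ_apply, reductionStep_toF5 hB hs']
    exact ih h

theorem reduction_toF5 {i : Fin (m + 1)} {G : List (LabeledBinomial n m)} {k : ℕ}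
    {s t : RedState n m} (hB : IsGroebner (binsAbove i G)) (h : reduction i G k s = some t) :
    F5.reduction (degRevLex n) i (G.map (LabeledBinomial.toF5 K)) (s.toF5 K) =
      some (t.toF5 K) :=
  have ⟨hiter, htodo⟩ := iterate_reductionStep_toF5 hB h
  F5.reduction_eq_some hiter (congrArg (List.map _) htodo)

end Correctness

/-! ### Runs -/

/-- The counterpart of `F5.State`, without `zeros`. -/
structure State (n m : ℕ) where
  cur : Fin (m + 1)
  G : List (LabeledBinomial n m)
  pairs : List (CritPair n m)
  count : ℕ
  rules : Rules n m

/-- The counterpart of `F5.inputPoly`. -/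
def inputBinomial (F : Fin (m + 1) → Binomial n) (i : Fin (m + 1)) : LabeledBinomial n m :=
  ⟨i, ⟨0, i⟩, (F i).monic⟩

namespace State

/-- The counterpart of `F5.State.init`. -/
def init (F : Fin (m + 1) → Binomial n) : State n m :=
  ⟨Fin.last m, [inputBinomial F (Fin.last m)], [], m + 1, []⟩

/-- The counterpart of `F5.State.startIteration`. -/
def startIteration (F : Fin (m + 1) → Binomial n) (i : Fin (m + 1)) (s : State n m) :
    State n m :=
  { s with
    cur := i
    G := s.G ++ [inputBinomial F i]
    pairs := s.G.filterMap (critPair i s.G (inputBinomial F i)) }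

/-- The counterpart of `F5.State.nextDegree`. -/
def nextDegree (s : State n m) : Option ℕ := (s.pairs.map CritPair.deg).min?

/-- The critical pairs of degree `d`. -/
def pairsOfDegree (d : ℕ) (s : State n m) : List (CritPair n m) := s.pairs.filter (·.deg = d)

/-- The counterpart of `F5.State.reduceDegree` for the list `l` of critical pairs. -/
def reduceDegree (l : List (CritPair n m)) (s : State n m) : Option (RedState n m) :=
  if IsGroebner (binsAbove s.cur s.G) then
    (spol l ⟨[], [], s.count, s.rules⟩).bind (reduction s.cur s.G fuel)
  else none

/-- The counterpart of `F5.State.addPoly`. -/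
def addBinomial (s : State n m) (r : LabeledBinomial n m) : State n m :=
  { s with
    pairs := s.pairs ++ s.G.filterMap (critPair s.cur s.G r)
    G := s.G ++ [r] }

/-- The counterpart of `F5.State.finishDegree`. -/
def finishDegree (d : ℕ) (s : State n m) (t : RedState n m) : State n m :=
  t.done.foldl addBinomial
    { s with
      pairs := s.pairs.filter (·.deg ≠ d)
      count := t.count
      rules := t.rules }

/-- Whatever the order of the critical pairs of degree `d`, `Reduction` returns a nonempty list
without new head terms. -/
def IsRedundantDegree (d : ℕ) (s : State n m) : Prop :=
  ∀ l ∈ (s.pairsOfDegree d).permutations', ∃ t ∈ s.reduceDegree l,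
    t.done ≠ [] ∧ ∀ r ∈ t.done, ∃ g ∈ s.G, g.bin.1 ≠ g.bin.2 ∧ g.ht ≤ r.ht
deriving Decidable

/-- The state of `F5` represented by `s`; nothing has been reduced to zero. -/
noncomputable def toF5 (K : Type*) [Field K] (s : State n m) : F5.State (Fin n) K m :=
  ⟨s.cur, s.G.map (LabeledBinomial.toF5 K), s.pairs.map (CritPair.toF5 K), s.count,
    s.rules.toF5, []⟩

end State

/-- After `k` steps from `s`, `P` holds whatever the order of the critical pairs of equal degree. -/
def HoldsAfter (F : Fin (m + 1) → Binomial n) (P : State n m → Prop) : ℕ → State n m → Prop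
  | 0, s => P s
  | k + 1, s =>
    match s.nextDegree with
    | some d => ∀ l ∈ (s.pairsOfDegree d).permutations', ∃ t ∈ s.reduceDegree l,
        HoldsAfter F P k (s.finishDegree d t)
    | none => ∃ _ : s.cur ≠ 0, HoldsAfter F P k (s.startIteration F ⟨s.cur - 1, by omega⟩)

instance {F : Fin (m + 1) → Binomial n} {P : State n m → Prop} [DecidablePred P] (k : ℕ)
    (s : State n m) : Decidable (HoldsAfter F P k s) := by
  induction k generalizing s with
  | zero => exact inferInstanceAs (Decidable (P s))
  | succ k ih =>
    rw [HoldsAfter]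
    split <;> infer_instance

section Correctness

variable {K : Type*} [Field K]

theorem exists_mem_permutations'_map_eq {α β : Type*} {f : α → β} {l : List α} {l' : List β}
    (h : l'.Perm (l.map f)) : ∃ l₁ ∈ l.permutations', l₁.map f = l' := by
  rwa [← List.mem_permutations', ← List.map_permutations', List.mem_map] at h

namespace State

theorem nextDegree_toF5 (s : State n m) : (s.toF5 K).nextDegree = s.nextDegree := by
  simp only [F5.State.nextDegree, toF5, nextDegree, List.map_map, Function.comp_def,
    CritPair.deg_toF5]

theorem exists_reduceDegree_toF5
    {sel : List (F5.CritPair (Fin n) K m) → List (F5.CritPair (Fin n) K m)}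
    (hsel : ∀ l, (sel l).Perm l) {s : State n m} {d : ℕ} {P : RedState n m → Prop}
    (h : ∀ l ∈ (s.pairsOfDegree d).permutations', ∃ t ∈ s.reduceDegree l, P t) :
    ∃ t, (s.toF5 K).reduceDegree (degRevLex n) sel d = some (t.toF5 K) ∧ P t := by
  have hpairs : (s.toF5 K).pairs.filter (fun p => p.deg = d) =
      (s.pairsOfDegree d).map (CritPair.toF5 K) := by
    simp only [toF5, pairsOfDegree, List.filter_map, Function.comp_def, CritPair.deg_toF5]
  obtain ⟨l, hl, hsel_eq⟩ :=
    exists_mem_permutations'_map_eq (hsel ((s.pairsOfDegree d).map (CritPair.toF5 K)))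
  obtain ⟨t, ht, hP⟩ := h l hl
  rw [Option.mem_def, reduceDegree] at ht
  split_ifs at ht with hB
  obtain ⟨t₁, hspol, hred⟩ := Option.bind_eq_some_iff.1 ht
  refine ⟨t, ?_, hP⟩
  rw [F5.State.reduceDegree, hpairs, ← hsel_eq, ← reduction_toF5 hB hred, ← spol_toF5 hspol]
  rfl

theorem addPoly_toF5 (s : State n m) (r : LabeledBinomial n m) :
    (s.toF5 K).addPoly (degRevLex n) (r.toF5 K) = (s.addBinomial r).toF5 K := by
  simp only [F5.State.addPoly, toF5, filterMap_critPair_toF5, addBinomial, List.map_append,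
    List.map_cons, List.map_nil]

theorem foldl_addPoly_toF5 (s : State n m) (l : List (LabeledBinomial n m)) :
    (l.map (LabeledBinomial.toF5 K)).foldl (F5.State.addPoly (degRevLex n)) (s.toF5 K) =
      (l.foldl addBinomial s).toF5 K := by
  induction l generalizing s with
  | nil => rfl
  | cons r l ih => rw [List.map_cons, List.foldl_cons, List.foldl_cons, addPoly_toF5, ih]

theorem finishDegree_toF5 (d : ℕ) (s : State n m) (t : RedState n m) :
    (s.toF5 K).finishDegree (degRevLex n) d (t.toF5 K) = (s.finishDegree d t).toF5 K := by
  rw [F5.State.finishDegree, finishDegree, ← foldl_addPoly_toF5]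
  simp only [toF5, RedState.toF5, List.filter_map, Function.comp_def, CritPair.deg_toF5]

variable {F : Fin (m + 1) → Binomial n}

theorem inputPoly_toF5 {i : Fin (m + 1)} (hF : (F i).1 ≠ (F i).2) :
    F5.inputPoly (degRevLex n) (fun i => binomial K (F i).toFinsupp) i =
      (inputBinomial F i).toF5 K := by
  rw [F5.inputPoly, Binomial.makeMonic_binomial_toFinsupp hF, inputBinomial,
    LabeledBinomial.toF5, Signature.toF5, Exponent.toFinsupp_zero]

theorem init_toF5 (hF : ∀ i, (F i).1 ≠ (F i).2) :
    F5.State.init (degRevLex n) (fun i => binomial K (F i).toFinsupp) = (init F).toF5 K := by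
  rw [F5.State.init, inputPoly_toF5 (hF _)]
  rfl

theorem startIteration_toF5 (hF : ∀ i, (F i).1 ≠ (F i).2) (i : Fin (m + 1)) (s : State n m) :
    (s.toF5 K).startIteration (degRevLex n) (fun i => binomial K (F i).toFinsupp) i =
      (s.startIteration F i).toF5 K := by
  simp only [F5.State.startIteration, toF5, inputPoly_toF5 (hF i), filterMap_critPair_toF5,
    startIteration, List.map_append, List.map_cons, List.map_nil]

end State

variable {F : Fin (m + 1) → Binomial n} {P : State n m → Prop}

theorem exists_run_add_of_holdsAfter (hF : ∀ i, (F i).1 ≠ (F i).2)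
    {sel : List (F5.CritPair (Fin n) K m) → List (F5.CritPair (Fin n) K m)}
    (hsel : ∀ l, (sel l).Perm l) {j k : ℕ} {s : State n m} (h : HoldsAfter F P k s)
    (hrun : F5.run (degRevLex n) sel (fun i => binomial K (F i).toFinsupp) j =
      some (s.toF5 K)) :
    ∃ s', P s' ∧ F5.run (degRevLex n) sel (fun i => binomial K (F i).toFinsupp) (j + k) =
      some (s'.toF5 K) := by
  induction k generalizing s j with
  | zero => exact ⟨s, h, hrun⟩
  | succ k ih =>
    rw [← Nat.add_assoc, Nat.add_right_comm]
    rw [HoldsAfter] at h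
    split at h
    · rename_i d hd
      obtain ⟨t, ht, h⟩ := State.exists_reduceDegree_toF5 hsel h
      refine ih h ?_
      simp only [F5.run, hrun, Option.bind_some, F5.State.step, State.nextDegree_toF5, hd, ht,
        Option.map_some, State.finishDegree_toF5]
    · rename_i hd
      obtain ⟨hcur, h⟩ := h
      refine ih h ?_
      have hcur' : (s.toF5 K).cur ≠ 0 := hcur
      simp only [F5.run, hrun, Option.bind_some, F5.State.step, State.nextDegree_toF5, hd,
        if_neg hcur', State.startIteration_toF5 hF]
      rfl

theorem exists_run_of_holdsAfter (hF : ∀ i, (F i).1 ≠ (F i).2)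
    {sel : List (F5.CritPair (Fin n) K m) → List (F5.CritPair (Fin n) K m)}
    (hsel : ∀ l, (sel l).Perm l) {k : ℕ} (h : HoldsAfter F P k (State.init F)) :
    ∃ s, P s ∧ F5.run (degRevLex n) sel (fun i => binomial K (F i).toFinsupp) k =
      some (s.toF5 K) := by
  have hrun : F5.run (degRevLex n) sel (fun i => binomial K (F i).toFinsupp) 0 =
      some ((State.init F).toF5 K) := congrArg some (State.init_toF5 hF)
  simpa only [Nat.zero_add] using exists_run_add_of_holdsAfter hF hsel h hrun

theorem State.IsRedundantDegree.exists_reduceDegree_toF5 {d : ℕ} {s : State n m}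
    (h : s.IsRedundantDegree d)
    {sel : List (F5.CritPair (Fin n) K m) → List (F5.CritPair (Fin n) K m)}
    (hsel : ∀ l, (sel l).Perm l) :
    ∃ R, (s.toF5 K).reduceDegree (degRevLex n) sel d = some R ∧ R.done ≠ [] ∧
      headIdeal (degRevLex n) (F5.polys ((s.toF5 K).G ++ R.done)) =
        headIdeal (degRevLex n) (F5.polys (s.toF5 K).G) ∧
      R.zeros = [] := by
  obtain ⟨t, ht, hne, hdvd⟩ := State.exists_reduceDegree_toF5 hsel h
  refine ⟨t.toF5 K, ht, List.map_eq_nil_iff.not.2 hne, ?_, rfl⟩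
  rw [F5.polys_append]
  refine headIdeal_union_eq ?_
  rintro _ ⟨_, hr, rfl⟩ -
  obtain ⟨r, hr', rfl⟩ := List.mem_map.1 hr
  obtain ⟨g, hg, hzero, hle⟩ := hdvd r hr'
  refine ⟨_, ⟨g.toF5 K, List.mem_map_of_mem hg, rfl⟩,
    mt binomial_eq_zero_iff.1 (mt Exponent.toFinsupp_inj.1 hzero), ?_⟩
  have hle' : (g.toF5 K).ht (degRevLex n) ≤ (r.toF5 K).ht (degRevLex n) := by
    rwa [LabeledBinomial.ht_toF5, LabeledBinomial.ht_toF5, Exponent.toFinsupp_le_toFinsupp]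
  exact hle'

end Correctness

/-! ### The example -/

/-- The polynomials of `faugereInput`. -/
def exampleInput : Fin 3 → Binomial 4 :=
  ![(![0, 1, 3, 0], ![2, 0, 0, 2]), (![1, 0, 2, 0], ![0, 2, 0, 1]),
    (![2, 1, 0, 0], ![0, 0, 2, 1])]

/-- The polynomials that F5 has found before degree `8` of its last iteration. -/
def exampleBasis : List (Binomial 4) :=
  let f := exampleInput
  let f₃ := sPair (f 1) (f 2)
  let f₄ := sPair f₃ (f 1)
  let f₅ := sPair (f 1) (f 0)
  let f₆ := sPair (f 2) (f 0)
  [f 2, f 1, f₃, f₄, f 0, f₅, f₆, sPair f₄ f₆, sPair f₆ (f 1)]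

/-- What the run on `exampleInput` leads to. -/
def IsExampleState (s : State 4 2) : Prop :=
  s.cur = 0 ∧ s.nextDegree = some 8 ∧ s.G.map (·.bin) = exampleBasis ∧ s.IsRedundantDegree 8
deriving Decidable

theorem holdsAfter_isExampleState :
    HoldsAfter exampleInput IsExampleState 7 (State.init exampleInput) := by
  decide +kernel

theorem precedes_of_mem_exampleBasis : ∀ b ∈ exampleBasis, Precedes b.2 b.1 := by
  decide +kernel

theorem joinableWithin_of_mem_exampleBasis :
    ∀ b ∈ exampleBasis, ∀ c ∈ exampleBasis, ∑ i, (sPair b c).1 i ≤ 7 →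
      JoinableWithin exampleBasis fuel (sPair b c) := by
  decide +kernel

variable (K : Type*) [Field K]

theorem binomial_exampleInput (i : Fin 3) :
    binomial K (exampleInput i).toFinsupp = faugereInput K i := by
  have hmonomial (a : Exponent 4) : MvPolynomial.monomial a.toFinsupp (1 : K) =
      MvPolynomial.X 0 ^ a 0 * MvPolynomial.X 1 ^ a 1 * MvPolynomial.X 2 ^ a 2 *
        MvPolynomial.X 3 ^ a 3 := by
    rw [MvPolynomial.monomial_eq, Finsupp.prod_fintype _ _ fun i => pow_zero _,
      Fin.prod_univ_four, MvPolynomial.C_1, one_mul]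
    rfl
  fin_cases i <;>
    simp [binomial, Binomial.toFinsupp, exampleInput, faugereInput, hmonomial]

theorem span_exampleBasis :
    Ideal.span (binomial K '' ruleSet exampleBasis) =
      Ideal.span (Set.range (faugereInput K)) := by
  apply le_antisymm <;> rw [Ideal.span_le]
  · rintro _ ⟨_, ⟨b, hb, rfl⟩, rfl⟩
    have hsPair {b c : Binomial 4}
        (hb : binomial K b.toFinsupp ∈ Ideal.span (Set.range (faugereInput K)))
        (hc : binomial K c.toFinsupp ∈ Ideal.span (Set.range (faugereInput K))) :
        binomial K (Binomial.toFinsupp (sPair b c)) ∈ Ideal.span (Set.range (faugereInput K)) :=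
      Binomial.toFinsupp_sPair b c ▸ binomial_sPair_mem hb hc
    have hf (i : Fin 3) : binomial K (exampleInput i).toFinsupp ∈
        Ideal.span (Set.range (faugereInput K)) :=
      Ideal.subset_span ⟨i, (binomial_exampleInput K i).symm⟩
    have hf₃ := hsPair (hf 1) (hf 2)
    have hf₄ := hsPair hf₃ (hf 1)
    have hf₅ := hsPair (hf 1) (hf 0)
    have hf₆ := hsPair (hf 2) (hf 0)
    simp only [exampleBasis, List.mem_cons, List.not_mem_nil, or_false] at hb
    rcases hb with rfl | rfl | rfl | rfl | rfl | rfl | rfl | rfl | rfl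
    exacts [hf 2, hf 1, hf₃, hf₄, hf 0, hf₅, hf₆, hsPair hf₄ hf₆, hsPair hf₆ (hf 1)]
  · rintro _ ⟨i, rfl⟩
    have hmem : ∀ i, exampleInput i ∈ exampleBasis := by decide
    exact Ideal.subset_span ⟨_, ⟨_, hmem i, rfl⟩, binomial_exampleInput K i⟩

theorem isGroebnerUpTo_exampleBasis :
    IsGroebnerUpTo (degRevLex 4) 7 (binomial K '' ruleSet exampleBasis)
      (Ideal.span (Set.range (faugereInput K))) := by
  rw [← span_exampleBasis]
  refine (isOriented_ruleSet precedes_of_mem_exampleBasis).isGroebnerUpTo_binomial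
    (exampleBasis.finite_toSet.image _) ?_
  rintro _ ⟨b, hb, rfl⟩ _ ⟨c, hc, rfl⟩ hdeg
  rw [← Binomial.toFinsupp_sPair] at hdeg ⊢
  exact (joinableWithin_of_mem_exampleBasis b hb c hc
    ((Exponent.degree_toFinsupp _).symm.trans_le hdeg)).join

theorem exists_run_faugereInput
    {sel : List (F5.CritPair (Fin 4) K 2) → List (F5.CritPair (Fin 4) K 2)}
    (hsel : ∀ l, (sel l).Perm l) :
    ∃ s, IsExampleState s ∧
      F5.run (degRevLex 4) sel (faugereInput K) 7 = some (s.toF5 K) := by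
  rw [← funext (binomial_exampleInput K)]
  exact exists_run_of_holdsAfter (by decide) hsel holdsAfter_isExampleState

end BinomialF5

theorem mainTheorem5 (K : Type*) [Field K]
    (sel : List (F5.CritPair (Fin 4) K 2) → List (F5.CritPair (Fin 4) K 2))
    (hsel : ∀ l, (sel l).Perm l) :
    ∃ (n : ℕ) (s : F5.State (Fin 4) K 2) (R : F5.RedState (Fin 4) K 2),
      F5.run (degRevLex 4) sel (faugereInput K) n = some s ∧
      s.cur = 0 ∧
      s.nextDegree = some 8 ∧
      s.reduceDegree (degRevLex 4) sel 8 = some R ∧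
      IsGroebnerUpTo (degRevLex 4) 7 (F5.polys s.G) (Ideal.span (Set.range (faugereInput K))) ∧
      R.done ≠ [] ∧
      headIdeal (degRevLex 4) (F5.polys (s.G ++ R.done)) =
        headIdeal (degRevLex 4) (F5.polys s.G) ∧
      R.zeros = [] := by
  obtain ⟨s, ⟨hcur, hdeg, hG, hredundant⟩, hrun⟩ := BinomialF5.exists_run_faugereInput K hsel
  obtain ⟨R, hR, hne, hhead, hzeros⟩ := hredundant.exists_reduceDegree_toF5 (K := K) hsel
  refine ⟨7, s.toF5 K, R, hrun, hcur, (s.nextDegree_toF5).trans hdeg, hR, ?_, hne, hhead, hzeros⟩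
  have hpolys : F5.polys (s.toF5 K).G =
      binomial K '' BinomialF5.ruleSet BinomialF5.exampleBasis :=
    hG ▸ BinomialF5.polys_toF5 s.G
  rw [hpolys]
  exact BinomialF5.isGroebnerUpTo_exampleBasis K
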